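/- **Setting.** Let $A\in\mathbb R^{m\times n}$, $b\in\mathbb R^m$, and for $\mu>0$ put $A_\mu=\begin{bmatrix}A\\ \mu I\end{bmatrix}$, $b_{\rm aug}=\begin{bmatrix}b\\0\end{bmatrix}$. Singular values $\sigma_1\ge\sigma_2\ge\cdots$ are in descending order (zero beyond the rank), and $\|\cdot\|_2$ is the spectral (or Euclidean) norm. *CUR approximation.* A CUR approximation of $A$ with target rank $\ell$ is $\widehat A_\ell=A(:,J)\,A(I,J)^\dagger A(I,:)$, where $I$ and $J$ consist of $\ell$ distinct row and $\ell$ distinct column indices and $\dagger$ is the Moore–Penrose pseudoinverse. *Preconditioner.* Given a rank-$\ell$ truncated SVD $\widehat A_\ell=\widehat U\,\mathrm{diag}(\hat\sigma_1,\dots,\hat\sigma_\ell)\widehat V^\top$ ($\widehat U,\widehat V$ with $\ell$ orthonormal columns, $\hat\sigma_1\ge\dots\ge\hat\sigma_\ell\ge0$) and a target level $\hat\sigma>0$, put $P_{\ell,\mu}=\hat\sigma^{-1}\widehat V(\widehat\Sigma^2+\mu^2I)^{1/2}\widehat V^\top+(I-\widehat V\widehat V^\top)$, where $\widehat\Sigma=\mathrm{diag}(\hat\sigma_1,\dots,\hat\sigma_\ell)$.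 *APLICUR with $p$ phases.* From an initial guess $x_0$, phase $i=1,\dots,p$ uses a rank $\ell_i\ge1$, a CUR approximation $\widehat A_{\ell_i}$ with residual $E^{(i)}=A-\widehat A_{\ell_i}$, a target level $\hat\sigma^{(i)}>0$, the resulting preconditioner $P_i=P_{\ell_i,\mu}$, and a number $k^{(i)}\ge0$ of LSQR iterations. It sets $x_i=x_{i-1}+P_i^{-1}y_i$, where $y_i$ is the $k^{(i)}$-th LSQR iterate (exact arithmetic) for the matrix $B_i=A_\mu P_i^{-1}$ and right-hand side $r=b_{\rm aug}-A_\mu x_{i-1}$. That is, $y_i$ minimizes $\|B_iy-r\|_2$ over $\mathrm{span}\{(B_i^\top B_i)^jB_i^\top r:0\le j<k^{(i)}\}$. Let $U_\mu\in\mathbb R^{(m+n)\times n}$ be the matrix of left singular vectors in a thin SVD of $A_\mu$. Let $r_0=A_\mu x_0-b_{\rm aug}$, and let $r_k=A_\mu x_p-b_{\rm aug}$ be the residual after all $k=\sum_i k^{(i)}$ iterations. **Claim.** (i) (CUR guarantee.) For every $0\le\ell\le\min(m,n)$ there is a CUR approximation $\widehat A_\ell$ of $A$ with target rank $\ell$ such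 that $$\|A-\widehat A_\ell\|_2\le C_*(\ell)\,\sigma_{\ell+1}(A),\qquad C_*(\ell)=\sqrt{1+\ell(\ell+2)(\min(m,n)-\ell)} .$$ (ii) (Convergence bound.) Let $C:\mathbb N\to\mathbb R$ be any function (for instance $C=C_*$). Suppose that for $i=1,\dots,p$ the CUR approximations used satisfy $\|E^{(i)}\|_2<\mu$ and $\|E^{(i)}\|_2\le C(\ell_i)\,\sigma_{\ell_i+1}(A)$, and that the target levels satisfy $\mu^2\le(\hat\sigma^{(i)})^2\le(\hat\sigma^{(i)}_{\ell_i})^2+\mu^2$, where $\hat\sigma^{(i)}_{\ell_i}$ is the $\ell_i$-th singular value of $\widehat A_{\ell_i}$. Then $$\|U_\mu^\top r_k\|_2\le 2^p\prod_{i=1}^p\left(1-\frac{2\bigl(\mu-C(\ell_i)\sigma_{\ell_i+1}(A)\bigr)}{\mu+\sqrt{(\hat\sigma^{(i)})^2+\mu^2}}\right)^{k^{(i)}}\|U_\mu^\top r_0\|_2 .$$ -/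

import Mathlib

open scoped Matrix Matrix.Norms.L2Operator

namespace APLICUR

/-- The Euclidean norm of a real vector. -/
noncomputable def euclNorm {α : Type*} [Fintype α] (v : α → ℝ) : ℝ :=
  ‖WithLp.toLp 2 v‖

/-- `sigma M i` is the `i`-th largest singular value of `M`, for `i = 1, 2, …`
(and `0` once `i` exceeds the number of columns). Mathlib's singular values start at index `0`. -/
noncomputable def sigma {m n : ℕ} (M : Matrix (Fin m) (Fin n) ℝ) (i : ℕ) : ℝ :=
  (Matrix.toEuclideanLin M).singularValues (i - 1)

/-- `X` is the Moore–Penrose pseudoinverse of `M` (the four Penrose equations). -/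
structure IsPseudoinverse {α β : Type*} [Fintype α] [Fintype β]
    (M : Matrix α β ℝ) (X : Matrix β α ℝ) : Prop where
  mul_mul : M * X * M = M
  mul_mul' : X * M * X = X
  symm_left : (M * X)ᵀ = M * X
  symm_right : (X * M)ᵀ = X * M

/-- A singular value decomposition `M = U diag(s) Vᵀ` with `k` singular triplets: `U` and `V` have
`k` orthonormal columns, and `s` is nonnegative and in descending order. -/
structure ThinSVD {α β : Type*} [Fintype α] [Fintype β] (M : Matrix α β ℝ) (k : ℕ) where
  U : Matrix α (Fin k) ℝ
  s : Fin k → ℝ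
  V : Matrix β (Fin k) ℝ
  U_orthonormal : Uᵀ * U = 1
  V_orthonormal : Vᵀ * V = 1
  s_antitone : Antitone s
  s_nonneg : ∀ j, 0 ≤ s j
  eq : M = U * Matrix.diagonal s * Vᵀ

/-- A CUR approximation of `A` with target rank `ℓ`: `ℓ` distinct rows, `ℓ` distinct columns, and
as core the pseudoinverse of the submatrix at their intersection. -/
structure CUR {m n : ℕ} (A : Matrix (Fin m) (Fin n) ℝ) (ℓ : ℕ) where
  rows : Fin ℓ ↪ Fin m
  cols : Fin ℓ ↪ Fin n
  core : Matrix (Fin ℓ) (Fin ℓ) ℝ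
  core_eq : IsPseudoinverse (A.submatrix rows cols) core

/-- The approximating matrix `A(:,J) A(I,J)† A(I,:)`. -/
def CUR.approx {m n : ℕ} {A : Matrix (Fin m) (Fin n) ℝ} {ℓ : ℕ} (c : CUR A ℓ) :
    Matrix (Fin m) (Fin n) ℝ :=
  A.submatrix id c.cols * c.core * A.submatrix c.rows id

/-- The residual `E = A - Â`. -/
def CUR.residual {m n : ℕ} {A : Matrix (Fin m) (Fin n) ℝ} {ℓ : ℕ} (c : CUR A ℓ) :
    Matrix (Fin m) (Fin n) ℝ :=
  A - c.approx

/-- The constant `√(1 + ℓ (ℓ + 2) (min(m,n) - ℓ))`, used for `ℓ ≤ min(m,n)`. -/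
noncomputable def curConstant (m n ℓ : ℕ) : ℝ :=
  √(1 + (ℓ : ℝ) * ((ℓ : ℝ) + 2) * (((min m n : ℕ) : ℝ) - (ℓ : ℝ)))

/-- The augmented matrix `[A; μ I]`. -/
def augMatrix {m n : ℕ} (A : Matrix (Fin m) (Fin n) ℝ) (μ : ℝ) :
    Matrix (Fin m ⊕ Fin n) (Fin n) ℝ :=
  Matrix.fromRows A (μ • (1 : Matrix (Fin n) (Fin n) ℝ))

/-- The augmented right-hand side `[b; 0]`. -/
def augVec {m : ℕ} (n : ℕ) (b : Fin m → ℝ) : Fin m ⊕ Fin n → ℝ :=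
  Sum.elim b 0

/-- The residual `A_μ x - b_aug`. -/
def augResidual {m n : ℕ} (A : Matrix (Fin m) (Fin n) ℝ) (b : Fin m → ℝ) (μ : ℝ)
    (x : Fin n → ℝ) : Fin m ⊕ Fin n → ℝ :=
  augMatrix A μ *ᵥ x - augVec n b

/-- The Krylov subspace `span {v, M v, …, M^(k-1) v}`. -/
def krylov {n : ℕ} (M : Matrix (Fin n) (Fin n) ℝ) (v : Fin n → ℝ) (k : ℕ) :
    Submodule ℝ (Fin n → ℝ) :=
  Submodule.span ℝ ((fun j : ℕ => (M ^ j) *ᵥ v) '' {j | j < k})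

/-- `y` is the `k`-th iterate (in exact arithmetic) of LSQR, started at `0`, for the least-squares
problem `min ‖B y - r‖₂`: it minimizes `‖B y - r‖₂` over the `k`-th Krylov subspace of `BᵀB`
and `Bᵀr`. -/
def IsLSQRIterate {α : Type*} [Fintype α] {n : ℕ} (B : Matrix α (Fin n) ℝ) (r : α → ℝ)
    (k : ℕ) (y : Fin n → ℝ) : Prop :=
  y ∈ krylov (Bᵀ * B) (Bᵀ *ᵥ r) k ∧
    ∀ z ∈ krylov (Bᵀ * B) (Bᵀ *ᵥ r) k, euclNorm (B *ᵥ y - r) ≤ euclNorm (B *ᵥ z - r)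

/-- The data of one phase: a CUR approximation `Â` of target rank `ℓ ≥ 1`, a rank-`ℓ` (truncated)
singular value decomposition of `Â`, a target level `σ̂ > 0`, and a number of LSQR iterations. -/
structure Phase {m n : ℕ} (A : Matrix (Fin m) (Fin n) ℝ) where
  rank : ℕ
  rank_pos : 0 < rank
  cur : CUR A rank
  svd : ThinSVD cur.approx rank
  level : ℝ
  level_pos : 0 < level
  iters : ℕ

/-- The smallest computed singular value `σ̂_ℓ` of `Â`. -/
def Phase.lastSigma {m n : ℕ} {A : Matrix (Fin m) (Fin n) ℝ} (ph : Phase A) : ℝ :=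
  ph.svd.s ⟨ph.rank - 1, Nat.sub_lt ph.rank_pos Nat.one_pos⟩

/-- The preconditioner `P = σ̂⁻¹ V̂ (Σ̂² + μ² I)^(1/2) V̂ᵀ + (I - V̂ V̂ᵀ)`. -/
noncomputable def Phase.precond {m n : ℕ} {A : Matrix (Fin m) (Fin n) ℝ} (ph : Phase A) (μ : ℝ) :
    Matrix (Fin n) (Fin n) ℝ :=
  (1 / ph.level) •
      (ph.svd.V * Matrix.diagonal (fun j => √(ph.svd.s j ^ 2 + μ ^ 2)) * ph.svd.Vᵀ) +
    (1 - ph.svd.V * ph.svd.Vᵀ)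

/-- One warm-started preconditioned LSQR phase takes `x` to
`x' = x + P⁻¹ y`, where `y` is the LSQR iterate for the preconditioned matrix `A_μ P⁻¹` and the
right-hand side `b_aug - A_μ x`. -/
def Phase.Step {m n : ℕ} {A : Matrix (Fin m) (Fin n) ℝ} (ph : Phase A) (b : Fin m → ℝ) (μ : ℝ)
    (x x' : Fin n → ℝ) : Prop :=
  ∃ y : Fin n → ℝ,
    IsLSQRIterate (augMatrix A μ * (ph.precond μ)⁻¹) (augVec n b - augMatrix A μ *ᵥ x) ph.iters y ∧
      x' = x + (ph.precond μ)⁻¹ *ᵥ y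

/-- `x 0, …, x p` are the successive outputs of the `p` phases, `x 0` being the initial guess. -/
def IsRun {m n p : ℕ} {A : Matrix (Fin m) (Fin n) ℝ} (b : Fin m → ℝ) (μ : ℝ)
    (phase : Fin p → Phase A) (x : Fin (p + 1) → Fin n → ℝ) : Prop :=
  ∀ i : Fin p, (phase i).Step b μ (x i.castSucc) (x i.succ)

end APLICUR

/-! (i) Average over all choices of `ℓ` rows and columns, weighted by squared minors. Bordering a
nonsingular `A(f,g)` by one row and column multiplies its determinant by an entry of the cross
residual (`det_submatrix_snoc`), so the mean squared Frobenius residual is at most `volume A (ℓ+1) /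
volume A ℓ`. By Cauchy–Binet these volumes are elementary symmetric functions of the squared
singular values, up to factorials (`volume_eq`), and the ratio is at most `(ℓ+1)²` times the tail
`∑_{j>ℓ} σ_j²`. Some choice does as well as the mean (`exists_cross`). Since the residual differs
from `A` by rank at most `ℓ`, its squared spectral norm leaves room for `∑_{j>ℓ+1} σ_j²` inside its
squared Frobenius norm (`norm_sub_le_sqrt_of_frobSq_le`). Subtracting this gives `1 +
ℓ(ℓ+2)(min(m,n)-ℓ)`. If all `ℓ × ℓ` minors vanish, a smaller skeleton is exact and is padded to size
`ℓ` (`exists_cur_exact`).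

(ii) Preconditioning the augmented CUR approximation puts its singular values between `μ` and the
level. As `P` does not shrink vectors, replacing `Â` by `A` moves these bounds by at most `‖E‖`. The
Chebyshev bound for LSQR (`IsLSQRIterate.euclNorm_le`) then contracts the range component of the
residual. Each warm start costs one factor 2, hence `2^p`. -/

namespace APLICUR

open Matrix Finset

/-! ### Cauchy–Binet and sums of squared minors -/

/-- The **Cauchy–Binet formula**, summed over all functions instead of over increasing ones. -/
theorem sum_det_submatrix_mul_det_submatrix {ι : Type*} [Fintype ι] {k : ℕ}
    (X : Matrix (Fin k) ι ℝ) (Y : Matrix ι (Fin k) ℝ) :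
    ∑ f : Fin k → ι, (X.submatrix id f).det * (Y.submatrix f id).det =
      (k.factorial : ℝ) * (X * Y).det := by
  classical
  have hXY : (X * Y).det = ∑ f : Fin k → ι, (∏ i, X i (f i)) * (Y.submatrix f id).det := by
    have h1 : (X * Y).det = Matrix.detRowAlternating (fun i => ∑ a, X i a • Y a) := by
      congr 1
      ext i j
      simp [Matrix.mul_apply]
    rw [h1]
    erw [MultilinearMap.map_sum]
    refine Finset.sum_congr rfl fun f _ => ?_
    erw [MultilinearMap.map_smul_univ]
    rfl
  -- Reindexing `f` to `f ∘ σ` permutes the rows of `Y`; the resulting sign cancels the sign of `σ`.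
  -- Hence each of the `k!` terms of the Leibniz expansion of the `X` minor contributes all of `det
  -- (XY)`.
  have hperm : ∀ σ : Equiv.Perm (Fin k),
      ∑ f : Fin k → ι, ((Equiv.Perm.sign σ : ℤ) : ℝ) * (∏ i, X (σ i) (f i)) *
        (Y.submatrix f id).det = (X * Y).det := by
    intro σ
    rw [hXY, ← (Equiv.arrowCongr σ.symm (Equiv.refl ι)).sum_comp]
    refine Finset.sum_congr rfl fun f _ => ?_
    have h2 : (Y.submatrix ((Equiv.arrowCongr σ.symm (Equiv.refl ι)) f) id).det =
        ((Equiv.Perm.sign σ : ℤ) : ℝ) * (Y.submatrix f id).det := by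
      have := Matrix.det_permute σ (Y.submatrix f id)
      rw [← this]
      rfl
    have h3 : ∏ i, X (σ i) ((Equiv.arrowCongr σ.symm (Equiv.refl ι)) f i) = ∏ i, X i (f i) :=
      Equiv.prod_comp σ fun i => X i (f i)
    have h4 : ((Equiv.Perm.sign σ : ℤ) : ℝ) * ((Equiv.Perm.sign σ : ℤ) : ℝ) = 1 := by
      rw [← Int.cast_mul, Int.units_coe_mul_self, Int.cast_one]
    rw [h2]
    calc _ = ((Equiv.Perm.sign σ : ℤ) : ℝ) * ((Equiv.Perm.sign σ : ℤ) : ℝ) *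
          (∏ i, X (σ i) ((Equiv.arrowCongr σ.symm (Equiv.refl ι)) f i)) *
          (Y.submatrix f id).det := by ring
      _ = _ := by rw [h4, h3, one_mul]
  calc ∑ f : Fin k → ι, (X.submatrix id f).det * (Y.submatrix f id).det
      = ∑ f : Fin k → ι, ∑ σ : Equiv.Perm (Fin k),
          ((Equiv.Perm.sign σ : ℤ) : ℝ) * (∏ i, X (σ i) (f i)) * (Y.submatrix f id).det := by
        refine Finset.sum_congr rfl fun f _ => ?_
        rw [Matrix.det_apply', Finset.sum_mul]
        rfl
    _ = (k.factorial : ℝ) * (X * Y).det := by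
        rw [Finset.sum_comm, Finset.sum_congr rfl fun σ _ => hperm σ]
        simp [Fintype.card_perm]

/-- The sum of the squares of all `k × k` minors, each one counted `(k!)²` times. -/
noncomputable def volume {m n : ℕ} (A : Matrix (Fin m) (Fin n) ℝ) (k : ℕ) : ℝ :=
  ∑ f : Fin k → Fin m, ∑ g : Fin k → Fin n, (A.submatrix f g).det ^ 2

theorem volume_nonneg {m n : ℕ} (A : Matrix (Fin m) (Fin n) ℝ) (k : ℕ) : 0 ≤ volume A k :=
  Finset.sum_nonneg fun _ _ => Finset.sum_nonneg fun _ _ => sq_nonneg _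

theorem volume_zero {m n : ℕ} (A : Matrix (Fin m) (Fin n) ℝ) : volume A 0 = 1 := by
  simp [volume]

/-- The sum of the products of `k` distinct entries of `w`, taken over all orderings. -/
noncomputable def esymmSum {n : ℕ} (w : Fin n → ℝ) (k : ℕ) : ℝ :=
  ∑ h : Fin k → Fin n, if Function.Injective h then ∏ i, w (h i) else 0

theorem sum_det_sq_eq {n k : ℕ} {ι : Type*} [Fintype ι] (A : Matrix ι (Fin n) ℝ)
    (g : Fin k → Fin n) :
    ∑ f : Fin k → ι, (A.submatrix f g).det ^ 2 =
      (k.factorial : ℝ) * ((Aᵀ * A).submatrix g g).det := by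
  have h := sum_det_submatrix_mul_det_submatrix (A.submatrix id g)ᵀ (A.submatrix id g)
  have h2 : (Aᵀ * A).submatrix g g = (A.submatrix id g)ᵀ * A.submatrix id g := by
    ext i j
    simp [Matrix.mul_apply]
  rw [h2, ← h]
  refine Finset.sum_congr rfl fun f _ => ?_
  have h3 : ((A.submatrix id g)ᵀ.submatrix id f) = (A.submatrix f g)ᵀ := rfl
  rw [h3, Matrix.det_transpose, sq]
  rfl

theorem det_submatrix_one {n k : ℕ} (h : Fin k → Fin n) :
    ((1 : Matrix (Fin n) (Fin n) ℝ).submatrix h h).det =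
      if Function.Injective h then 1 else 0 := by
  split_ifs with hh
  · rw [Matrix.submatrix_one h hh, Matrix.det_one]
  · simp only [Function.Injective, not_forall] at hh
    obtain ⟨i, j, hij, hne⟩ := hh
    exact Matrix.det_zero_of_row_eq hne (funext fun x =>
      congrArg (fun a => (1 : Matrix (Fin n) (Fin n) ℝ) a (h x)) hij)

/-- Cauchy–Binet is applied three times: to sum over rows, to expand the principal minors of `Q
diag(w) Qᵀ`, and, after exchanging sums, to collapse `∑_g det Q(g,h)²` to `k!` or `0` by
orthogonality. -/
theorem volume_eq {m n : ℕ} (A : Matrix (Fin m) (Fin n) ℝ) (Q : Matrix (Fin n) (Fin n) ℝ)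
    (w : Fin n → ℝ) (hQ : Qᵀ * Q = 1) (hA : Aᵀ * A = Q * Matrix.diagonal w * Qᵀ) (k : ℕ) :
    volume A k = (k.factorial : ℝ) * esymmSum w k := by
  have hk : (k.factorial : ℝ) ≠ 0 := by exact_mod_cast k.factorial_ne_zero
  have h1 : volume A k = ∑ g : Fin k → Fin n,
      (k.factorial : ℝ) * ((Aᵀ * A).submatrix g g).det := by
    rw [volume, Finset.sum_comm]
    exact Finset.sum_congr rfl fun g _ => sum_det_sq_eq A g
  have h2 : ∀ g : Fin k → Fin n, (k.factorial : ℝ) * ((Aᵀ * A).submatrix g g).det =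
      ∑ h : Fin k → Fin n, (∏ i, w (h i)) * (Q.submatrix g h).det ^ 2 := by
    intro g
    have h3 : (Aᵀ * A).submatrix g g =
        (Q * Matrix.diagonal w).submatrix g id * (Q.submatrix g id)ᵀ := by
      rw [hA]
      ext i j
      simp [Matrix.mul_apply]
    rw [h3, ← sum_det_submatrix_mul_det_submatrix]
    refine Finset.sum_congr rfl fun h _ => ?_
    have h4 : ((Q * Matrix.diagonal w).submatrix g id).submatrix id h =
        Q.submatrix g h * Matrix.diagonal (fun i => w (h i)) := by
      ext i j
      simp
    have h5 : ((Q.submatrix g id)ᵀ.submatrix h id) = (Q.submatrix g h)ᵀ := rfl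
    rw [h4, h5, Matrix.det_mul, Matrix.det_transpose, Matrix.det_diagonal]
    ring
  rw [h1, Finset.sum_congr rfl fun g _ => h2 g, Finset.sum_comm, esymmSum, Finset.mul_sum]
  refine Finset.sum_congr rfl fun h _ => ?_
  rw [← Finset.mul_sum, sum_det_sq_eq, hQ, det_submatrix_one]
  split_ifs <;> ring

/-- Pigeonhole: among `k + 1` distinct indices one is at least `k`. Removing it leaves an injective
`k`-tuple, and there are `k + 1` positions it may have occupied. -/
theorem esymmSum_succ_le {n : ℕ} {w : Fin n → ℝ} (hw : ∀ i, 0 ≤ w i) (k : ℕ) :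
    esymmSum w (k + 1) ≤
      ((k : ℝ) + 1) * (∑ j : Fin n, if k ≤ (j : ℕ) then w j else 0) * esymmSum w k := by
  have h1 : ∀ h : Fin (k + 1) → Fin n,
      (if Function.Injective h then ∏ i, w (h i) else 0) ≤
        ∑ i, (if k ≤ (h i : ℕ) then w (h i) else 0) *
          (if Function.Injective (i.removeNth h) then ∏ j, w (i.removeNth h j) else 0) := by
    intro h
    have hnn : ∀ i, 0 ≤ (if k ≤ (h i : ℕ) then w (h i) else 0) *
          (if Function.Injective (i.removeNth h) then ∏ j, w (i.removeNth h j) else 0) := by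
      intro i
      refine mul_nonneg (by split_ifs; exacts [hw _, le_rfl]) ?_
      split_ifs
      exacts [Finset.prod_nonneg fun i _ => hw _, le_rfl]
    split_ifs with hh
    · obtain ⟨i, hi⟩ : ∃ i, k ≤ (h i : ℕ) := by
        by_contra! hc
        have := Fintype.card_le_of_injective (fun i => (⟨h i, hc i⟩ : Fin k)) (by
          intro a b hab
          exact hh (Fin.ext (by simpa using hab)))
        simp at this
      refine le_trans (le_of_eq ?_) (Finset.single_le_sum (fun i _ => hnn i) (Finset.mem_univ i))
      have hinj : Function.Injective (i.removeNth h) :=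
        hh.comp (Fin.succAbove_right_injective)
      rw [if_pos hi, if_pos hinj, Fin.prod_univ_succAbove _ i]
      rfl
    · exact Finset.sum_nonneg fun i _ => hnn i
  refine (Finset.sum_le_sum fun h _ => h1 h).trans (le_of_eq ?_)
  rw [Finset.sum_comm]
  have h2 : ∀ i : Fin (k + 1), ∑ h : Fin (k + 1) → Fin n,
      (if k ≤ (h i : ℕ) then w (h i) else 0) *
          (if Function.Injective (i.removeNth h) then ∏ j, w (i.removeNth h j) else 0) =
      (∑ j : Fin n, if k ≤ (j : ℕ) then w j else 0) * esymmSum w k := by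
    intro i
    rw [← (Fin.insertNthEquiv (fun _ => Fin n) i).sum_comp, Fintype.sum_prod_type, esymmSum,
      Finset.sum_mul_sum]
    simp [Fin.insertNthEquiv]
  rw [Finset.sum_congr rfl fun i _ => h2 i]
  simp [mul_assoc]

theorem volume_succ_le {m n : ℕ} (A : Matrix (Fin m) (Fin n) ℝ) (Q : Matrix (Fin n) (Fin n) ℝ)
    (w : Fin n → ℝ) (hw : ∀ i, 0 ≤ w i) (hQ : Qᵀ * Q = 1)
    (hA : Aᵀ * A = Q * Matrix.diagonal w * Qᵀ) (k : ℕ) :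
    volume A (k + 1) ≤
      ((k : ℝ) + 1) ^ 2 * (∑ j : Fin n, if k ≤ (j : ℕ) then w j else 0) * volume A k := by
  rw [volume_eq A Q w hQ hA, volume_eq A Q w hQ hA, Nat.factorial_succ]
  push_cast
  have := mul_le_mul_of_nonneg_left (esymmSum_succ_le hw k)
    (by positivity : (0 : ℝ) ≤ ((k : ℝ) + 1) * (k.factorial : ℝ))
  linarith

/-! ### Cross approximation and volume sampling -/

/-- The cross approximation `A(:,g) A(f,g)⁻¹ A(f,:)`. -/
noncomputable def cross {m n k : ℕ} (A : Matrix (Fin m) (Fin n) ℝ) (f : Fin k → Fin m)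
    (g : Fin k → Fin n) : Matrix (Fin m) (Fin n) ℝ :=
  A.submatrix id g * (A.submatrix f g)⁻¹ * A.submatrix f id

/-- The residual entry is the `1 × 1` Schur complement of `A(f,g)` in the bordered matrix. -/
theorem det_submatrix_snoc {m n k : ℕ} (A : Matrix (Fin m) (Fin n) ℝ) (f : Fin k → Fin m)
    (g : Fin k → Fin n) (h : (A.submatrix f g).det ≠ 0) (i : Fin m) (j : Fin n) :
    (A.submatrix (Fin.snoc f i : Fin (k + 1) → Fin m) (Fin.snoc g j : Fin (k + 1) → Fin n)).det =
      (A.submatrix f g).det * (A - cross A f g) i j := by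
  have hinv : Invertible (A.submatrix f g) :=
    Matrix.invertibleOfIsUnitDet _ (isUnit_iff_ne_zero.mpr h)
  have h1 : (A.submatrix (Fin.snoc f i : Fin (k + 1) → Fin m)
      (Fin.snoc g j : Fin (k + 1) → Fin n)).submatrix finSumFinEquiv finSumFinEquiv =
      Matrix.fromBlocks (A.submatrix f g) (A.submatrix f fun _ : Fin 1 => j)
        (A.submatrix (fun _ : Fin 1 => i) g) (A.submatrix (fun _ => i) fun _ => j) := by
    have hl : ∀ a : Fin k, finSumFinEquiv (Sum.inl a : Fin k ⊕ Fin 1) = Fin.castSucc a :=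
      fun a => rfl
    have hr : ∀ a : Fin 1, finSumFinEquiv (Sum.inr a : Fin k ⊕ Fin 1) = Fin.last k := by
      intro a
      ext
      simp
    ext (a | a) (b | b) <;> simp [hl, hr, -finSumFinEquiv_apply_left, -finSumFinEquiv_apply_right]
  rw [← Matrix.det_submatrix_equiv_self (finSumFinEquiv : Fin k ⊕ Fin 1 ≃ Fin (k + 1)), h1,
    Matrix.det_fromBlocks₁₁, Matrix.invOf_eq_nonsing_inv]
  congr 1
  rw [Matrix.det_fin_one]
  simp [cross, Matrix.mul_apply]

/-- Each `(k+1)`-tuple is a `k`-tuple with one index appended, so the Schur complement formula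
applies termwise. It is only an inequality because singular `A(f,g)` give zero on the left. -/
theorem sum_det_sq_mul_le {m n : ℕ} (A : Matrix (Fin m) (Fin n) ℝ) (k : ℕ) :
    ∑ f : Fin k → Fin m, ∑ g : Fin k → Fin n,
      (A.submatrix f g).det ^ 2 * ∑ i, ∑ j, ((A - cross A f g) i j) ^ 2 ≤ volume A (k + 1) := by
  have h1 : volume A (k + 1) = ∑ f : Fin k → Fin m, ∑ g : Fin k → Fin n, ∑ i, ∑ j,
      (A.submatrix (Fin.snoc f i : Fin (k + 1) → Fin m)
        (Fin.snoc g j : Fin (k + 1) → Fin n)).det ^ 2 := by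
    rw [volume, ← (Fin.snocEquiv fun _ => Fin m).sum_comp, Fintype.sum_prod_type, Finset.sum_comm]
    refine Finset.sum_congr rfl fun f _ => ?_
    rw [Finset.sum_comm (s := (Finset.univ : Finset (Fin k → Fin n)))]
    refine Finset.sum_congr rfl fun i _ => ?_
    rw [← (Fin.snocEquiv fun _ => Fin n).sum_comp, Fintype.sum_prod_type, Finset.sum_comm]
    rfl
  rw [h1]
  refine Finset.sum_le_sum fun f _ => Finset.sum_le_sum fun g _ => ?_
  by_cases h : (A.submatrix f g).det = 0
  · rw [h]
    simp only [ne_eq, OfNat.ofNat_ne_zero, not_false_eq_true, zero_pow, zero_mul]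
    positivity
  · rw [Finset.mul_sum]
    refine Finset.sum_le_sum fun i _ => ?_
    rw [Finset.mul_sum]
    refine Finset.sum_le_sum fun j _ => ?_
    rw [det_submatrix_snoc A f g h, mul_pow]

/-- Volume sampling yields a good cross approximation in the Frobenius norm. -/
theorem exists_cross {m n : ℕ} (A : Matrix (Fin m) (Fin n) ℝ) (k : ℕ) (hv : volume A k ≠ 0) :
    ∃ (f : Fin k → Fin m) (g : Fin k → Fin n), (A.submatrix f g).det ≠ 0 ∧
      (∑ i, ∑ j, ((A - cross A f g) i j) ^ 2) * volume A k ≤ volume A (k + 1) := by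
  by_contra! hc
  have hpos : 0 < volume A k := lt_of_le_of_ne (volume_nonneg A k) (Ne.symm hv)
  have key : ∀ f : Fin k → Fin m, ∀ g : Fin k → Fin n,
      (A.submatrix f g).det ^ 2 * volume A (k + 1) ≤
      (A.submatrix f g).det ^ 2 * (∑ i, ∑ j, ((A - cross A f g) i j) ^ 2) * volume A k := by
    intro f g
    by_cases h : (A.submatrix f g).det = 0
    · simp [h]
    · rw [mul_assoc]
      exact mul_le_mul_of_nonneg_left (hc f g h).le (sq_nonneg _)
  obtain ⟨f₀, -, hf₀⟩ := Finset.exists_ne_zero_of_sum_ne_zero hv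
  obtain ⟨g₀, -, hg₀⟩ := Finset.exists_ne_zero_of_sum_ne_zero hf₀
  have hd : (A.submatrix f₀ g₀).det ≠ 0 := fun h => hg₀ (by simp [h])
  have hlt : volume A k * volume A (k + 1) < (∑ f : Fin k → Fin m, ∑ g : Fin k → Fin n,
      (A.submatrix f g).det ^ 2 * ∑ i, ∑ j, ((A - cross A f g) i j) ^ 2) * volume A k := by
    -- Making the residual sums opaque keeps `Finset.sum_mul` from distributing into them.
    generalize hS : (fun (f : Fin k → Fin m) (g : Fin k → Fin n) =>
      ∑ i, ∑ j, ((A - cross A f g) i j) ^ 2) = S at key hc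
    have hS' : ∀ f g, ∑ i, ∑ j, ((A - cross A f g) i j) ^ 2 = S f g := fun f g => by rw [← hS]
    simp only [hS'] at key hc ⊢
    conv_lhs => rw [volume]
    simp only [Finset.sum_mul]
    refine Finset.sum_lt_sum (fun f _ => Finset.sum_le_sum fun g _ => key f g)
      ⟨f₀, Finset.mem_univ _, ?_⟩
    refine Finset.sum_lt_sum (fun g _ => key f₀ g) ⟨g₀, Finset.mem_univ _, ?_⟩
    rw [mul_assoc]
    exact mul_lt_mul_of_pos_left (hc f₀ g₀ hd) (by positivity)
  have := mul_le_mul_of_nonneg_right (sum_det_sq_mul_le A k) hpos.le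
  linarith

/-! ### Gram matrices, pseudoinverses and Bessel's inequality -/

theorem euclNorm_sq {α : Type*} [Fintype α] (v : α → ℝ) : euclNorm v ^ 2 = v ⬝ᵥ v := by
  rw [euclNorm, EuclideanSpace.norm_sq_eq]
  simp [dotProduct, sq]

theorem euclNorm_nonneg {α : Type*} [Fintype α] (v : α → ℝ) : 0 ≤ euclNorm v := norm_nonneg _

theorem mulVec_dotProduct_mulVec {α β : Type*} [Fintype α] [Fintype β] (M : Matrix α β ℝ)
    (x y : β → ℝ) : (M *ᵥ x) ⬝ᵥ (M *ᵥ y) = x ⬝ᵥ ((Mᵀ * M) *ᵥ y) := by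
  rw [← Matrix.mulVec_mulVec, Matrix.dotProduct_mulVec x, Matrix.vecMul_transpose]

/-- The singular values and right singular vectors diagonalize the Gram matrix. -/
theorem exists_gram_diagonalization {ι : Type*} [Fintype ι] {n : ℕ} (A : Matrix ι (Fin n) ℝ) :
    ∃ Q : Matrix (Fin n) (Fin n) ℝ, Qᵀ * Q = 1 ∧ Q * Qᵀ = 1 ∧
      Aᵀ * A = Q * Matrix.diagonal
        (fun i : Fin n => (Matrix.toEuclideanLin A).singularValues i ^ 2) * Qᵀ := by
  classical
  set T := Matrix.toEuclideanLin A
  have hn : Module.finrank ℝ (EuclideanSpace ℝ (Fin n)) = n := by simp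
  set q := T.isSymmetric_adjoint_comp_self.eigenvectorBasis hn
  let Q : Matrix (Fin n) (Fin n) ℝ := Matrix.of fun a i => q i a
  have hQ : Qᵀ * Q = 1 := by
    ext i j
    have := orthonormal_iff_ite.mp q.orthonormal i j
    rw [PiLp.inner_apply] at this
    simp only [Matrix.mul_apply, Matrix.transpose_apply, Matrix.one_apply]
    rw [← this]
    refine Finset.sum_congr rfl fun a _ => ?_
    simp [Q, mul_comm]
  have hQ' : Q * Qᵀ = 1 := mul_eq_one_comm.mp hQ
  refine ⟨Q, hQ, hQ', ?_⟩
  have h1 : Aᵀ * A * Q = Q * Matrix.diagonal (fun i : Fin n => T.singularValues i ^ 2) := by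
    ext a i
    have h2 := T.isSymmetric_adjoint_comp_self.apply_eigenvectorBasis hn i
    rw [← T.sq_singularValues_fin hn i] at h2
    have h3 := congrArg (fun v : EuclideanSpace ℝ (Fin n) => v a) h2
    have h4 : ((LinearMap.adjoint T ∘ₗ T) (q i)) a = ((Aᵀ * A) *ᵥ (q i).ofLp) a := by
      rw [LinearMap.comp_apply, ← Matrix.toEuclideanLin_conjTranspose_eq_adjoint,
        Matrix.ofLp_toLpLin, Matrix.ofLp_toLpLin, Matrix.toLin'_apply, Matrix.toLin'_apply,
        Matrix.mulVec_mulVec, Matrix.conjTranspose_eq_transpose_of_trivial]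
    change ((LinearMap.adjoint T ∘ₗ T) (q i)) a = _ at h3
    rw [h4] at h3
    rw [Matrix.mul_diagonal]
    change ((Aᵀ * A) *ᵥ (q i).ofLp) a = _
    rw [h3]
    simp [Q, q, mul_comm]
  rw [← h1, Matrix.mul_assoc, hQ', Matrix.mul_one]

theorem exists_pseudoinverse {k : ℕ} (M : Matrix (Fin k) (Fin k) ℝ) :
    ∃ X, IsPseudoinverse M X := by
  obtain ⟨Q, hQ, hQ', hM⟩ := exists_gram_diagonalization M
  set w : Fin k → ℝ := fun i => (Matrix.toEuclideanLin M).singularValues i ^ 2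
  set D := Matrix.diagonal w
  -- With `0⁻¹ = 0` this is the pseudoinverse of `D`, so no rank splitting is needed.
  set D' := Matrix.diagonal fun i => (w i)⁻¹
  set N := M * Q with hN
  have hNN : Nᵀ * N = D := by
    rw [hN, Matrix.transpose_mul, Matrix.mul_assoc, ← Matrix.mul_assoc Mᵀ, hM]
    calc Qᵀ * (Q * D * Qᵀ * Q) = (Qᵀ * Q) * D * (Qᵀ * Q) := by simp only [Matrix.mul_assoc]
      _ = D := by rw [hQ, Matrix.one_mul, Matrix.mul_one]
  have hND : N * (D' * D) = N := by
    ext a i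
    rw [Matrix.diagonal_mul_diagonal, Matrix.mul_diagonal]
    by_cases h : w i = 0
    · have h1 := congrFun (congrFun hNN i) i
      rw [Matrix.mul_apply, show D i i = 0 from (Matrix.diagonal_apply_eq w i).trans h] at h1
      have h2 := (Finset.sum_eq_zero_iff_of_nonneg
        (fun b _ => by simpa using mul_self_nonneg (N b i))).mp h1 a (Finset.mem_univ a)
      have h3 : N a i = 0 := by simpa using h2
      rw [h3, zero_mul]
    · rw [inv_mul_cancel₀ h, mul_one]
  have hMN : M = N * Qᵀ := by rw [hN, Matrix.mul_assoc, hQ', Matrix.mul_one]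
  have hD' : D'ᵀ = D' := Matrix.diagonal_transpose _
  have hDD : D' * D * D' = D' := by
    rw [Matrix.diagonal_mul_diagonal, Matrix.diagonal_mul_diagonal]
    congr 1
    ext i
    by_cases h : w i = 0
    · simp [h]
    · field_simp
  have hMX : M * (Q * D' * Nᵀ) = N * D' * Nᵀ := by rw [hN]; simp only [Matrix.mul_assoc]
  have hXM : Q * D' * Nᵀ * M = Q * (D' * D) * Qᵀ := by
    rw [← hNN, hMN]; simp only [Matrix.mul_assoc]
  refine ⟨Q * D' * Nᵀ, ?_, ?_, ?_, ?_⟩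
  · rw [Matrix.mul_assoc, hXM, ← Matrix.mul_assoc, ← Matrix.mul_assoc, ← hN, hND, ← hMN]
  · rw [hXM]
    calc Q * (D' * D) * Qᵀ * (Q * D' * Nᵀ) = Q * (D' * D) * (Qᵀ * Q) * (D' * Nᵀ) := by
          simp only [Matrix.mul_assoc]
      _ = Q * (D' * D * D') * Nᵀ := by rw [hQ, Matrix.mul_one]; simp only [Matrix.mul_assoc]
      _ = _ := by rw [hDD]
  · rw [hMX]
    simp [Matrix.transpose_mul, hD', Matrix.mul_assoc]
  · rw [hXM, Matrix.diagonal_mul_diagonal]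
    simp [Matrix.transpose_mul, Matrix.mul_assoc]

/-- Bessel's inequality for the columns of a matrix with orthonormal columns. -/
theorem transpose_mulVec_dotProduct_le {α κ : Type*} [Fintype α] [Fintype κ] [DecidableEq κ]
    {W : Matrix α κ ℝ} (hW : Wᵀ * W = 1) (r : α → ℝ) : (Wᵀ *ᵥ r) ⬝ᵥ (Wᵀ *ᵥ r) ≤ r ⬝ᵥ r := by
  have h0 : 0 ≤ (r - W *ᵥ (Wᵀ *ᵥ r)) ⬝ᵥ (r - W *ᵥ (Wᵀ *ᵥ r)) := by
    rw [← euclNorm_sq]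
    exact sq_nonneg _
  have h1 : r ⬝ᵥ (W *ᵥ (Wᵀ *ᵥ r)) = (Wᵀ *ᵥ r) ⬝ᵥ (Wᵀ *ᵥ r) := by
    rw [Matrix.dotProduct_mulVec, Matrix.mulVec_transpose]
  have h2 : (W *ᵥ (Wᵀ *ᵥ r)) ⬝ᵥ (W *ᵥ (Wᵀ *ᵥ r)) = (Wᵀ *ᵥ r) ⬝ᵥ (Wᵀ *ᵥ r) := by
    rw [mulVec_dotProduct_mulVec, hW, Matrix.one_mulVec]
  rw [sub_dotProduct, dotProduct_sub, dotProduct_sub, h2,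
    dotProduct_comm (W *ᵥ (Wᵀ *ᵥ r)) r, h1] at h0
  linarith

/-! ### From Frobenius to spectral error -/

/-- The squared Frobenius norm. -/
def frobSq {α β : Type*} [Fintype α] [Fintype β] (M : Matrix α β ℝ) : ℝ :=
  ∑ i, ∑ j, M i j ^ 2

theorem frobSq_mul_le {α β κ : Type*} [Fintype α] [Fintype β] [Fintype κ] [DecidableEq κ]
    {W : Matrix β κ ℝ} (hW : Wᵀ * W = 1) (M : Matrix α β ℝ) : frobSq (M * W) ≤ frobSq M := by
  refine Finset.sum_le_sum fun i _ => ?_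
  have := transpose_mulVec_dotProduct_le hW (M i)
  simpa [dotProduct, Matrix.mulVec, Matrix.mul_apply, sq, mul_comm] using this

theorem frobSq_eq_trace {α β : Type*} [Fintype α] [Fintype β] (M : Matrix α β ℝ) :
    frobSq M = (Mᵀ * M).trace := by
  rw [frobSq, Finset.sum_comm]
  simp [Matrix.trace, Matrix.mul_apply, sq]

/-- An orthonormal basis of the kernel of a matrix, written as the columns of a matrix. -/
theorem exists_orthonormal_kernel {ρ : Type*} [Fintype ρ] {n : ℕ} (M : Matrix ρ (Fin n) ℝ) :
    ∃ (d : ℕ) (W : Matrix (Fin n) (Fin d) ℝ), n ≤ d + Fintype.card ρ ∧ Wᵀ * W = 1 ∧ M * W = 0 := by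
  classical
  set T := Matrix.toEuclideanLin M
  let b := stdOrthonormalBasis ℝ (LinearMap.ker T)
  refine ⟨Module.finrank ℝ (LinearMap.ker T),
    Matrix.of fun a j => (b j : EuclideanSpace ℝ (Fin n)) a, ?_, ?_, ?_⟩
  · have h1 := T.finrank_range_add_finrank_ker
    have h2 := (LinearMap.range T).finrank_le
    simp only [finrank_euclideanSpace, Fintype.card_fin] at h1 h2
    omega
  · ext i j
    have := orthonormal_iff_ite.mp b.orthonormal i j
    rw [Submodule.coe_inner, PiLp.inner_apply] at this
    simp only [Matrix.mul_apply, Matrix.transpose_apply, Matrix.one_apply]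
    rw [← this]
    refine Finset.sum_congr rfl fun a _ => ?_
    exact mul_comm _ _
  · ext i j
    have h1 : T (b j) = 0 := LinearMap.mem_ker.mp (b j).2
    have h2 := congrArg (fun v : EuclideanSpace ℝ ρ => v i) h1
    exact h2

/-- Ky Fan's inequality for the smallest singular values. -/
theorem tail_le_frobSq_mul {ι : Type*} [Fintype ι] {n d k : ℕ} (A : Matrix ι (Fin n) ℝ)
    (W : Matrix (Fin n) (Fin d) ℝ) (hW : Wᵀ * W = 1) (hd : n ≤ d + (k + 1)) :
    ∑ j : Fin n, (if k + 1 ≤ (j : ℕ) then (Matrix.toEuclideanLin A).singularValues j ^ 2 else 0) ≤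
      frobSq (A * W) := by
  obtain ⟨Q, hQ, hQ', hA⟩ := exists_gram_diagonalization A
  set s := (Matrix.toEuclideanLin A).singularValues
  set c := Qᵀ * W with hc
  -- `p i` is the squared length of the projection of the `i`-th right singular vector onto the
  -- range of `W`: weights in `[0,1]` with sum `d`.
  set p : Fin n → ℝ := fun i => ∑ j, c i j ^ 2 with hp
  have hcc : cᵀ * c = 1 := by
    rw [hc, Matrix.transpose_mul, Matrix.transpose_transpose, Matrix.mul_assoc,
      ← Matrix.mul_assoc Q, hQ', Matrix.one_mul, hW]
  have hfrob : frobSq (A * W) = ∑ i : Fin n, s i ^ 2 * p i := by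
    rw [frobSq_eq_trace, Matrix.transpose_mul, Matrix.mul_assoc, ← Matrix.mul_assoc Aᵀ, hA]
    have : Wᵀ * (Q * Matrix.diagonal (fun i : Fin n => s i ^ 2) * Qᵀ * W) =
        cᵀ * (Matrix.diagonal (fun i : Fin n => s i ^ 2) * c) := by
      rw [hc, Matrix.transpose_mul, Matrix.transpose_transpose]
      simp only [Matrix.mul_assoc]
    rw [this]
    simp only [Matrix.trace, Matrix.diag_apply, Matrix.mul_apply (M := cᵀ), Matrix.transpose_apply,
      Matrix.diagonal_mul, hp, Finset.mul_sum]
    rw [Finset.sum_comm]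
    exact Finset.sum_congr rfl fun i _ => Finset.sum_congr rfl fun j _ => by ring
  have hp0 : ∀ i, 0 ≤ p i := fun i => Finset.sum_nonneg fun j _ => sq_nonneg _
  have hp1 : ∀ i, p i ≤ 1 := by
    intro i
    have := transpose_mulVec_dotProduct_le hcc (Pi.single i 1)
    rw [single_dotProduct, Pi.single_eq_same, one_mul] at this
    simpa [dotProduct, ← sq, hp] using this
  have hps : ∑ i, p i = d := by
    have : ∑ i, p i = (cᵀ * c).trace := by rw [← frobSq_eq_trace]; rfl
    rw [this, hcc, Matrix.trace_one, Fintype.card_fin]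
  rw [hfrob]
  have hanti : ∀ {i j : ℕ}, i ≤ j → s j ^ 2 ≤ s i ^ 2 := fun h =>
    pow_le_pow_left₀ (LinearMap.singularValues_nonneg _ _) (LinearMap.singularValues_antitone _ h) 2
  have hind : ∑ i : Fin n, (if k + 1 ≤ (i : ℕ) then (1 : ℝ) else 0) ≤ d := by
    rw [Fin.sum_univ_eq_sum_range (fun i => if k + 1 ≤ i then (1 : ℝ) else 0) n,
      ← Finset.sum_filter]
    have hsub : (Finset.range n).filter (fun i => k + 1 ≤ i) = Finset.Ico (k + 1) n := by
      ext; simp; omega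
    rw [hsub, Finset.sum_const, Nat.card_Ico, nsmul_eq_mul, mul_one, Nat.cast_le]
    omega
  -- The level `s k ^ 2` separates the two regimes: from `k + 1` on, `p i - 1 ≤ 0` meets a smaller
  -- `s i`; before that, `p i ≥ 0` meets a larger one.
  have hterm : ∀ i : Fin n, s k ^ 2 * (p i - if k + 1 ≤ (i : ℕ) then 1 else 0) ≤
      s i ^ 2 * p i - if k + 1 ≤ (i : ℕ) then s i ^ 2 else 0 := by
    intro i
    split_ifs with h
    · have := hanti (show k ≤ (i : ℕ) by omega)
      nlinarith [hp1 i]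
    · have := hanti (show (i : ℕ) ≤ k by omega)
      nlinarith [hp0 i]
  have hsum := Finset.sum_le_sum fun i (_ : i ∈ Finset.univ) => hterm i
  rw [← Finset.mul_sum, Finset.sum_sub_distrib, Finset.sum_sub_distrib, hps] at hsum
  have : 0 ≤ s k ^ 2 * ((d : ℝ) - ∑ i : Fin n, if k + 1 ≤ (i : ℕ) then (1 : ℝ) else 0) :=
    mul_nonneg (sq_nonneg _) (by linarith)
  linarith

theorem norm_le_of_euclNorm_mulVec_le {α : Type*} [Fintype α] {n : ℕ} (M : Matrix α (Fin n) ℝ)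
    {c : ℝ} (hc : 0 ≤ c) (h : ∀ v, euclNorm (M *ᵥ v) ≤ c * euclNorm v) : ‖M‖ ≤ c := by
  rw [Matrix.l2_opNorm_def]
  refine ContinuousLinearMap.opNorm_le_bound _ hc fun v => ?_
  exact h v.ofLp

theorem euclNorm_mulVec_le {α : Type*} [Fintype α] {n : ℕ} (M : Matrix α (Fin n) ℝ)
    (v : Fin n → ℝ) : euclNorm (M *ᵥ v) ≤ ‖M‖ * euclNorm v :=
  Matrix.l2_opNorm_mulVec M (WithLp.toLp 2 v)

theorem euclNorm_smul {α : Type*} [Fintype α] (c : ℝ) (v : α → ℝ) :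
    euclNorm (c • v) = |c| * euclNorm v := by
  rw [euclNorm, WithLp.toLp_smul, norm_smul, Real.norm_eq_abs, euclNorm]

/-- The squared spectral norm of the residual of a rank-`k` approximation, plus the squares of the
singular values of `A` from index `k + 1` on, is at most the squared Frobenius norm. -/
theorem norm_sub_le_sqrt_of_frobSq_le {m n k : ℕ} (A : Matrix (Fin m) (Fin n) ℝ)
    (X : Matrix (Fin m) (Fin k) ℝ) (Y : Matrix (Fin k) (Fin n) ℝ) {F : ℝ}
    (hF : frobSq (A - X * Y) ≤ F + ∑ j : Fin n,
      (if k + 1 ≤ (j : ℕ) then (Matrix.toEuclideanLin A).singularValues j ^ 2 else 0))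
    (hF0 : 0 ≤ F) :
    ‖A - X * Y‖ ≤ √F := by
  set E := A - X * Y with hE
  have hunit : ∀ v : Fin n → ℝ, v ⬝ᵥ v = 1 → (E *ᵥ v) ⬝ᵥ (E *ᵥ v) ≤ F := by
    intro v hv
    -- The columns of `W` span the vectors killed by `Y` and orthogonal to `v`: codimension at most
    -- `k + 1`, and there the residual agrees with `A`. Prepending `v` keeps the columns
    -- orthonormal.
    obtain ⟨d, W, hd, hW, hMW⟩ := exists_orthonormal_kernel
      (Matrix.fromRows Y (Matrix.replicateRow (Fin 1) v))
    rw [Matrix.fromRows_mul, ← Matrix.fromRows_zero, Matrix.fromRows_inj.eq_iff] at hMW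
    have hvW : v ᵥ* W = 0 := by
      ext j
      have := congrFun (congrFun hMW.2 0) j
      simpa [Matrix.mul_apply, Matrix.vecMul, dotProduct] using this
    simp only [Fintype.card_sum, Fintype.card_fin] at hd
    have hEW : E * W = A * W := by
      rw [hE, Matrix.sub_mul, Matrix.mul_assoc, hMW.1, Matrix.mul_zero, sub_zero]
    have hky := tail_le_frobSq_mul A W hW hd
    set W' := Matrix.fromCols (Matrix.replicateCol (Fin 1) v) W with hW'
    have hWW : W'ᵀ * W' = 1 := by
      rw [hW', Matrix.transpose_fromCols, Matrix.fromRows_mul_fromCols, hW,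
        ← Matrix.fromBlocks_one]
      congr 1
      · ext i j
        simpa [Matrix.mul_apply, dotProduct, Matrix.one_apply, Subsingleton.elim i j] using hv
      · ext i j
        have := congrFun hvW j
        simpa [Matrix.mul_apply, Matrix.vecMul, dotProduct] using this
      · ext i j
        have := congrFun hvW i
        simpa [Matrix.mul_apply, Matrix.vecMul, dotProduct, mul_comm] using this
    have h1 := frobSq_mul_le hWW E
    have h2 : frobSq (E * W') = (E *ᵥ v) ⬝ᵥ (E *ᵥ v) + frobSq (E * W) := by
      rw [hW', Matrix.mul_fromCols, frobSq, frobSq, dotProduct, ← Finset.sum_add_distrib]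
      refine Finset.sum_congr rfl fun i _ => ?_
      rw [Fintype.sum_sum_type]
      simp [Matrix.mul_apply, Matrix.mulVec, dotProduct, sq]
    rw [hEW] at h2
    linarith
  refine norm_le_of_euclNorm_mulVec_le _ (Real.sqrt_nonneg _) fun v => ?_
  have hgen : (E *ᵥ v) ⬝ᵥ (E *ᵥ v) ≤ F * (v ⬝ᵥ v) := by
    by_cases hv : v = 0
    · simp [hv]
    have hpos : 0 < euclNorm v := by
      rw [euclNorm, norm_pos_iff]
      simpa using hv
    have h1 := hunit ((euclNorm v)⁻¹ • v) (by
      rw [← euclNorm_sq, euclNorm_smul, abs_of_pos (inv_pos.mpr hpos), inv_mul_cancel₀ hpos.ne',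
        one_pow])
    rw [Matrix.mulVec_smul, smul_dotProduct, dotProduct_smul, smul_eq_mul, smul_eq_mul] at h1
    rw [← euclNorm_sq v]
    have h2 : (E *ᵥ v) ⬝ᵥ (E *ᵥ v) =
        (euclNorm v)⁻¹ * ((euclNorm v)⁻¹ * ((E *ᵥ v) ⬝ᵥ (E *ᵥ v))) * euclNorm v ^ 2 := by
      field_simp
    rw [h2]
    exact mul_le_mul_of_nonneg_right h1 (sq_nonneg _)
  refine le_of_sq_le_sq ?_ (mul_nonneg (Real.sqrt_nonneg _) (euclNorm_nonneg _))
  rwa [mul_pow, Real.sq_sqrt hF0, euclNorm_sq, euclNorm_sq]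

/-! ### Singular value tails and the CUR guarantee -/

theorem singularValues_eq_zero_of_le {m n : ℕ} (A : Matrix (Fin m) (Fin n) ℝ) {i : ℕ}
    (hi : m ≤ i) : (Matrix.toEuclideanLin A).singularValues i = 0 := by
  rw [LinearMap.singularValues_eq_zero_iff_le_finrank_range]
  refine ((LinearMap.range (Matrix.toEuclideanLin A)).finrank_le).trans ?_
  simpa using hi

theorem tail_le {m n k : ℕ} (A : Matrix (Fin m) (Fin n) ℝ) (hk : k ≤ min m n) :
    ∑ j : Fin n, (if k ≤ (j : ℕ) then (Matrix.toEuclideanLin A).singularValues j ^ 2 else 0) ≤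
      (((min m n : ℕ) : ℝ) - k) * (Matrix.toEuclideanLin A).singularValues k ^ 2 := by
  set s := (Matrix.toEuclideanLin A).singularValues with hs
  have hterm : ∀ i ∈ Finset.range n, (if k ≤ i then s i ^ 2 else 0) ≤
      if i ∈ Finset.Ico k (min m n) then s k ^ 2 else 0 := by
    intro i hi
    have h0 : (0 : ℝ) ≤ s k ^ 2 := sq_nonneg _
    by_cases h1 : k ≤ i
    · by_cases h2 : i < m
      · rw [if_pos h1, if_pos (by simp at hi ⊢; omega)]
        exact pow_le_pow_left₀ (LinearMap.singularValues_nonneg _ _)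
          (LinearMap.singularValues_antitone _ h1) 2
      · rw [hs, singularValues_eq_zero_of_le A (not_lt.mp h2)]
        split_ifs <;> simp
        positivity
    · rw [if_neg h1]
      split_ifs <;> simp
      positivity
  rw [Fin.sum_univ_eq_sum_range (fun i => if k ≤ i then s i ^ 2 else 0) n]
  refine (Finset.sum_le_sum hterm).trans ?_
  rw [← Finset.sum_filter, Finset.sum_const, nsmul_eq_mul, ← Nat.cast_sub hk]
  refine mul_le_mul_of_nonneg_right ?_ (sq_nonneg _)
  rw [Nat.cast_le, ← Nat.card_Ico]
  exact Finset.card_le_card fun i hi => (Finset.mem_filter.mp hi).2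

theorem tail_succ {n k : ℕ} {m : ℕ} (A : Matrix (Fin m) (Fin n) ℝ) :
    ∑ j : Fin n, (if k ≤ (j : ℕ) then (Matrix.toEuclideanLin A).singularValues j ^ 2 else 0) =
      (Matrix.toEuclideanLin A).singularValues k ^ 2 + ∑ j : Fin n,
        (if k + 1 ≤ (j : ℕ) then (Matrix.toEuclideanLin A).singularValues j ^ 2 else 0) := by
  set s := (Matrix.toEuclideanLin A).singularValues with hs
  by_cases hk : k < n
  · have : ∀ j : Fin n, (if k ≤ (j : ℕ) then s j ^ 2 else 0) =
        (if j = ⟨k, hk⟩ then s k ^ 2 else 0) + if k + 1 ≤ (j : ℕ) then s j ^ 2 else 0 := by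
      intro j
      rcases lt_trichotomy (j : ℕ) k with h | h | h
      · rw [if_neg (by omega), if_neg (by intro hj; simp [hj] at h), if_neg (by omega), add_zero]
      · rw [if_pos h.ge, if_pos (Fin.ext h), if_neg (by omega), h, add_zero]
      · rw [if_pos h.le, if_neg (by intro hj; simp [hj] at h), if_pos (by omega), zero_add]
    rw [Finset.sum_congr rfl fun j _ => this j, Finset.sum_add_distrib]
    simp
  · have h0 : s k = 0 := LinearMap.singularValues_of_finrank_le _ (by simpa using hk)
    rw [h0, Finset.sum_eq_zero, Finset.sum_eq_zero] <;> simp <;> intros <;> omega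

theorem injective_of_det_submatrix_ne_zero {m n k : ℕ} {A : Matrix (Fin m) (Fin n) ℝ}
    {f : Fin k → Fin m} {g : Fin k → Fin n} (h : (A.submatrix f g).det ≠ 0) :
    Function.Injective f ∧ Function.Injective g := by
  constructor
  · intro i j hij
    by_contra hne
    exact h (Matrix.det_zero_of_row_eq hne
      (funext fun x => by simp only [submatrix_apply]; rw [hij]))
  · intro i j hij
    by_contra hne
    exact h (Matrix.det_zero_of_column_eq hne fun x => by simp only [submatrix_apply]; rw [hij])

/-- A CUR approximation is exact if its row and column sets contain a nonsingular skeleton. -/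
theorem exists_cur_exact {m n r ℓ : ℕ} (A : Matrix (Fin m) (Fin n) ℝ) {f : Fin r → Fin m}
    {g : Fin r → Fin n} (hdet : (A.submatrix f g).det ≠ 0) (hA : A = cross A f g) (hr : r ≤ ℓ)
    (hℓ : ℓ ≤ min m n) : ∃ c : CUR A ℓ, c.residual = 0 := by
  obtain ⟨hf, hg⟩ := injective_of_det_submatrix_ne_zero hdet
  obtain ⟨I, hI⟩ := Fin.Embedding.restrictSurjective_of_le_natCard hr
    (by simpa using hℓ.trans (min_le_left m n)) (⟨f, hf⟩ : Fin r ↪ Fin m)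
  obtain ⟨J, hJ⟩ := Fin.Embedding.restrictSurjective_of_le_natCard hr
    (by simpa using hℓ.trans (min_le_right m n)) (⟨g, hg⟩ : Fin r ↪ Fin n)
  have hI' : ∀ i, I (Fin.castLE hr i) = f i := fun i => DFunLike.congr_fun hI i
  have hJ' : ∀ i, J (Fin.castLE hr i) = g i := fun i => DFunLike.congr_fun hJ i
  obtain ⟨X, hX⟩ := exists_pseudoinverse (A.submatrix I J)
  refine ⟨⟨I, J, X, hX⟩, ?_⟩
  have hunit : IsUnit (A.submatrix f g).det := isUnit_iff_ne_zero.mpr hdet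
  set F := A.submatrix id g * (A.submatrix f g)⁻¹ with hF
  set H := A.submatrix f id with hH
  have hFH : A = F * H := hA
  set FI := F.submatrix I id with hFI
  set HJ := H.submatrix id J with hHJ
  have hM : A.submatrix I J = FI * HJ := by
    conv_lhs => rw [hFH]
    rfl
  -- Among the rows `I` of `F` are the rows `f`, which form an identity block; `HJ` likewise
  -- contains the invertible `A(f,g)`. So `FI` has a left inverse and `HJ` a right inverse.
  have hL : (1 : Matrix (Fin ℓ) (Fin ℓ) ℝ).submatrix (Fin.castLE hr) id * FI = 1 := by
    have h1 : (1 : Matrix (Fin ℓ) (Fin ℓ) ℝ).submatrix (Fin.castLE hr) id * FI =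
        A.submatrix f g * (A.submatrix f g)⁻¹ := by
      ext i j
      simp [Matrix.mul_apply, Matrix.one_apply, hFI, hF, hI']
    rw [h1, Matrix.mul_nonsing_inv _ hunit]
  have hR : HJ * ((1 : Matrix (Fin ℓ) (Fin ℓ) ℝ).submatrix id (Fin.castLE hr) *
      (A.submatrix f g)⁻¹) = 1 := by
    have h1 : HJ * (1 : Matrix (Fin ℓ) (Fin ℓ) ℝ).submatrix id (Fin.castLE hr) =
        A.submatrix f g := by
      ext i j
      simp [Matrix.mul_apply, Matrix.one_apply, hHJ, hH, hJ']
    rw [← Matrix.mul_assoc, h1, Matrix.mul_nonsing_inv _ hunit]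
  set L := (1 : Matrix (Fin ℓ) (Fin ℓ) ℝ).submatrix (Fin.castLE hr) id
  set R := (1 : Matrix (Fin ℓ) (Fin ℓ) ℝ).submatrix id (Fin.castLE hr) * (A.submatrix f g)⁻¹
  -- These one-sided inverses cancel the outer factors in `M X M = M`.
  have hcore : HJ * X * FI = 1 := by
    have h1 := hX.mul_mul
    rw [hM] at h1
    calc HJ * X * FI = (L * FI) * (HJ * X * FI) * (HJ * R) := by
          rw [hL, hR, Matrix.one_mul, Matrix.mul_one]
      _ = L * (FI * HJ * X * (FI * HJ)) * R := by simp only [Matrix.mul_assoc]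
      _ = (L * FI) * (HJ * R) := by rw [h1]; simp only [Matrix.mul_assoc]
      _ = 1 := by rw [hL, hR, Matrix.one_mul]
  have hC : A.submatrix id J = F * HJ := by
    conv_lhs => rw [hFH]
    rfl
  have hRow : A.submatrix I id = FI * H := by
    conv_lhs => rw [hFH]
    rfl
  have happ : A.submatrix id J * X * A.submatrix I id = A := by
    rw [hC, hRow]
    calc F * HJ * X * (FI * H) = F * (HJ * X * FI) * H := by simp only [Matrix.mul_assoc]
      _ = A := by rw [hcore, Matrix.mul_one, ← hFH]
  rw [CUR.residual, CUR.approx]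
  exact sub_eq_zero.mpr happ.symm

theorem exists_cur_norm_residual_le {m n : ℕ} (A : Matrix (Fin m) (Fin n) ℝ) (ℓ : ℕ)
    (hℓ : ℓ ≤ min m n) :
    ∃ c : CUR A ℓ, ‖c.residual‖ ≤ curConstant m n ℓ * sigma A (ℓ + 1) := by
  have hs0 : 0 ≤ sigma A (ℓ + 1) := LinearMap.singularValues_nonneg _ _
  by_cases hv : volume A ℓ = 0
  · classical
    have hex : ∃ r, volume A r = 0 := ⟨ℓ, hv⟩
    -- The last size before the volume first vanishes: there the sampling bound has right side zero
    -- and forces an exact cross approximation.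
    obtain ⟨r, hr⟩ : ∃ r, Nat.find hex = r + 1 := by
      refine Nat.exists_eq_succ_of_ne_zero fun h0 => ?_
      have := Nat.find_spec hex
      rw [h0, volume_zero] at this
      exact one_ne_zero this
    have hr1 : volume A (r + 1) = 0 := hr ▸ Nat.find_spec hex
    have hr0 : volume A r ≠ 0 := Nat.find_min hex (by omega)
    have hrℓ : r + 1 ≤ ℓ := hr ▸ Nat.find_min' hex hv
    obtain ⟨f, g, hdet, hle⟩ := exists_cross A r hr0
    have hpos : 0 < volume A r := lt_of_le_of_ne (volume_nonneg A r) hr0.symm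
    rw [hr1] at hle
    have hfrob : ∑ i, ∑ j, ((A - cross A f g) i j) ^ 2 = 0 :=
      le_antisymm (nonpos_of_mul_nonpos_left hle hpos)
        (Finset.sum_nonneg fun i _ => Finset.sum_nonneg fun j _ => sq_nonneg _)
    have hA : A = cross A f g := by
      rw [← sub_eq_zero]
      ext i j
      have h1 := (Finset.sum_eq_zero_iff_of_nonneg
        (fun i _ => Finset.sum_nonneg fun j _ => sq_nonneg _)).mp hfrob i (Finset.mem_univ i)
      have h2 := (Finset.sum_eq_zero_iff_of_nonneg fun j _ => sq_nonneg _).mp h1 j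
        (Finset.mem_univ j)
      exact pow_eq_zero_iff two_ne_zero |>.mp h2
    obtain ⟨c, hc⟩ := exists_cur_exact A hdet hA (by omega) hℓ
    refine ⟨c, ?_⟩
    rw [hc, norm_zero]
    exact mul_nonneg (Real.sqrt_nonneg _) hs0
  · obtain ⟨f, g, hdet, hle⟩ := exists_cross A ℓ hv
    obtain ⟨hf, hg⟩ := injective_of_det_submatrix_ne_zero hdet
    have hpos : 0 < volume A ℓ := lt_of_le_of_ne (volume_nonneg A ℓ) (Ne.symm hv)
    have hunit : IsUnit (A.submatrix f g).det := isUnit_iff_ne_zero.mpr hdet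
    have hpi : IsPseudoinverse (A.submatrix f g) (A.submatrix f g)⁻¹ := by
      constructor <;> simp [Matrix.mul_nonsing_inv _ hunit, Matrix.nonsing_inv_mul _ hunit]
    refine ⟨⟨⟨f, hf⟩, ⟨g, hg⟩, (A.submatrix f g)⁻¹, hpi⟩, ?_⟩
    change ‖A - A.submatrix id g * (A.submatrix f g)⁻¹ * A.submatrix f id‖ ≤ _
    obtain ⟨Q, hQ, -, hA⟩ := exists_gram_diagonalization A
    have hfrob : frobSq (A - cross A f g) ≤ ((ℓ : ℝ) + 1) ^ 2 *
        ∑ j : Fin n, (if ℓ ≤ (j : ℕ) then (Matrix.toEuclideanLin A).singularValues j ^ 2 else 0) :=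
      le_of_mul_le_mul_right (hle.trans (volume_succ_le A Q _ (fun i => sq_nonneg _) hQ hA ℓ)) hpos
    have htail := tail_le A hℓ
    have hsucc := tail_succ (k := ℓ) A
    set s := (Matrix.toEuclideanLin A).singularValues with hs
    have hsig : sigma A (ℓ + 1) = s ℓ := rfl
    have hmin : (0 : ℝ) ≤ ((min m n : ℕ) : ℝ) - ℓ := by
      rw [sub_nonneg]
      exact_mod_cast hℓ
    have hconst : (0 : ℝ) ≤ 1 + (ℓ : ℝ) * ((ℓ : ℝ) + 2) * (((min m n : ℕ) : ℝ) - (ℓ : ℝ)) := by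
      positivity
    have hfin : curConstant m n ℓ * sigma A (ℓ + 1) =
        √((1 + (ℓ : ℝ) * ((ℓ : ℝ) + 2) * (((min m n : ℕ) : ℝ) - (ℓ : ℝ))) * s ℓ ^ 2) := by
      rw [Real.sqrt_mul hconst, Real.sqrt_sq (hsig ▸ hs0), hsig, curConstant]
    rw [hfin]
    refine norm_sub_le_sqrt_of_frobSq_le A _ _ ?_ (by positivity)
    refine hfrob.trans ?_
    -- Subtracting the tail from `ℓ + 1` splits `(ℓ+1)²` tails into `ℓ(ℓ+2)` tails plus a single `s
    -- ℓ ^ 2`.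
    have h1 := mul_le_mul_of_nonneg_left htail
      (by positivity : (0 : ℝ) ≤ (ℓ : ℝ) * ((ℓ : ℝ) + 2))
    linear_combination h1 + hsucc

/-! ### Chebyshev polynomials and LSQR convergence -/

theorem abs_eval_chebyshev_le_one {x : ℝ} (hx : |x| ≤ 1) (k : ℕ) :
    |(Polynomial.Chebyshev.T ℝ k).eval x| ≤ 1 := by
  obtain ⟨h1, h2⟩ := abs_le.mp hx
  rw [← Real.cos_arccos h1 h2, Polynomial.Chebyshev.T_real_cos]
  exact Real.abs_cos_le_one _

theorem pow_div_two_le_eval_chebyshev {z : ℝ} (hz : 1 ≤ z) (k : ℕ) :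
    z ^ k / 2 ≤ (Polynomial.Chebyshev.T ℝ k).eval ((z + z⁻¹) / 2) := by
  have hz0 : 0 < z := by linarith
  rw [← Real.cosh_log hz0, Polynomial.Chebyshev.T_real_cosh, Real.cosh_eq, Int.cast_natCast,
    ← Real.log_pow, Real.exp_log (by positivity)]
  linarith [Real.exp_pos (-Real.log (z ^ k))]

/-- The scaled Chebyshev polynomial with value `1` at `0` that is small on `[a², b²]`. -/
theorem exists_chebyshev_residual {a b : ℝ} (ha : 0 < a) (hab : a < b) (k : ℕ) :
    ∃ p : Polynomial ℝ, p.natDegree ≤ k ∧ p.coeff 0 = 1 ∧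
      ∀ t, a ^ 2 ≤ t → t ≤ b ^ 2 → |p.eval t| ≤ 2 * ((b - a) / (b + a)) ^ k := by
  have hba : 0 < b - a := sub_pos.mpr hab
  have hb : 0 < b + a := by linarith
  have hd : 0 < b ^ 2 - a ^ 2 := by nlinarith
  -- `x₀` is the image of `0` under the decreasing affine map of `[a², b²]` onto `[-1, 1]`. Writing
  -- it as `(z + z⁻¹)/2` makes `z⁻¹` the convergence rate.
  set x₀ := (b ^ 2 + a ^ 2) / (b ^ 2 - a ^ 2) with hx₀
  set z := (b + a) / (b - a) with hz
  have hzx : x₀ = (z + z⁻¹) / 2 := by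
    rw [hx₀, hz, inv_div]
    have : b ^ 2 - a ^ 2 = (b + a) * (b - a) := by ring
    rw [this]
    field_simp
    ring
  have hz1 : 1 ≤ z := by
    rw [hz, le_div_iff₀ hba]
    linarith
  set T := Polynomial.Chebyshev.T ℝ (k : ℤ)
  have hT : z ^ k / 2 ≤ T.eval x₀ := hzx ▸ pow_div_two_le_eval_chebyshev hz1 k
  have hzk : 0 < z ^ k := by positivity
  have hT0 : 0 < T.eval x₀ := by linarith
  set L : Polynomial ℝ := Polynomial.C (-2 / (b ^ 2 - a ^ 2)) * Polynomial.X + Polynomial.C x₀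
  have hL : ∀ t, L.eval t = (b ^ 2 + a ^ 2 - 2 * t) / (b ^ 2 - a ^ 2) := by
    intro t
    simp only [L, hx₀, Polynomial.eval_add, Polynomial.eval_mul, Polynomial.eval_C,
      Polynomial.eval_X]
    ring
  refine ⟨Polynomial.C (T.eval x₀)⁻¹ * T.comp L, ?_, ?_, ?_⟩
  · refine (Polynomial.natDegree_C_mul_le _ _).trans (Polynomial.natDegree_comp_le.trans ?_)
    have h1 : T.natDegree = k := by simp [T]
    rw [h1]
    exact (Nat.mul_le_mul_left k (Polynomial.natDegree_linear_le)).trans (by simp)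
  · rw [Polynomial.coeff_zero_eq_eval_zero, Polynomial.eval_mul, Polynomial.eval_C,
      Polynomial.eval_comp, hL, mul_zero, sub_zero]
    exact inv_mul_cancel₀ hT0.ne'
  · intro t ht1 ht2
    rw [Polynomial.eval_mul, Polynomial.eval_C, Polynomial.eval_comp, hL, abs_mul,
      abs_of_pos (inv_pos.mpr hT0)]
    have h1 : |T.eval ((b ^ 2 + a ^ 2 - 2 * t) / (b ^ 2 - a ^ 2))| ≤ 1 := by
      refine abs_eval_chebyshev_le_one ?_ k
      rw [abs_div, abs_of_pos hd, div_le_one hd, abs_le]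
      constructor <;> linarith
    have h2 : (T.eval x₀)⁻¹ ≤ (z ^ k / 2)⁻¹ := inv_anti₀ (by positivity) hT
    have h3 : (z ^ k / 2)⁻¹ = 2 * ((b - a) / (b + a)) ^ k := by
      rw [inv_div, hz, div_pow, div_pow]
      field_simp
    calc _ ≤ (T.eval x₀)⁻¹ * 1 := mul_le_mul_of_nonneg_left h1 (inv_pos.mpr hT0).le
      _ ≤ _ := by rw [mul_one, ← h3]; exact h2

theorem aeval_conj_diagonal {n : ℕ} {Q : Matrix (Fin n) (Fin n) ℝ} (hQ : Qᵀ * Q = 1)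
    (hQ' : Q * Qᵀ = 1) (w : Fin n → ℝ) (p : Polynomial ℝ) :
    Polynomial.aeval (Q * Matrix.diagonal w * Qᵀ) p =
      Q * Matrix.diagonal (fun i => p.eval (w i)) * Qᵀ := by
  induction p using Polynomial.induction_on' with
  | add p q hp hq =>
    rw [map_add, hp, hq, ← Matrix.add_mul, ← Matrix.mul_add, Matrix.diagonal_add]
    simp
  | monomial j c =>
    have hpow : (Q * Matrix.diagonal w * Qᵀ) ^ j = Q * Matrix.diagonal (fun i => w i ^ j) * Qᵀ := by
      induction j with
      | zero => simp [hQ']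
      | succ j ih =>
        rw [pow_succ, ih]
        calc _ = Q * Matrix.diagonal (fun i => w i ^ j) * (Qᵀ * Q) * Matrix.diagonal w * Qᵀ := by
              simp only [Matrix.mul_assoc]
          _ = _ := by
              rw [hQ, Matrix.mul_one, Matrix.mul_assoc Q, Matrix.diagonal_mul_diagonal]
              rfl
    have hsm : Matrix.diagonal (fun i => c * w i ^ j) = c • Matrix.diagonal (fun i => w i ^ j) := by
      rw [← Matrix.diagonal_smul]
      rfl
    simp only [Polynomial.aeval_monomial, hpow, Polynomial.eval_monomial, hsm,
      ← Algebra.smul_def, Matrix.mul_smul, Matrix.smul_mul]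

theorem euclNorm_of_orthonormal {α κ : Type*} [Fintype α] [Fintype κ] [DecidableEq κ]
    {W : Matrix α κ ℝ} (hW : Wᵀ * W = 1) (c : κ → ℝ) : euclNorm (W *ᵥ c) = euclNorm c := by
  rw [← sq_eq_sq₀ (euclNorm_nonneg _) (euclNorm_nonneg _), euclNorm_sq, euclNorm_sq,
    mulVec_dotProduct_mulVec, hW, Matrix.one_mulVec]

theorem euclNorm_eq_zero {α : Type*} [Fintype α] {v : α → ℝ} : euclNorm v = 0 ↔ v = 0 := by
  rw [euclNorm, norm_eq_zero, WithLp.toLp_eq_zero]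

/-- In an eigenbasis of `BᵀB` the polynomial acts by the scalars `p(w i)`, and the two norm bounds,
tested on eigenvectors, place every `w i` in `[a², b²]`. -/
theorem euclNorm_mulVec_aeval_le {α : Type*} [Fintype α] {n : ℕ} (B : Matrix α (Fin n) ℝ) {a b : ℝ}
    (ha : 0 ≤ a) (hlo : ∀ y, a * euclNorm y ≤ euclNorm (B *ᵥ y))
    (hhi : ∀ y, euclNorm (B *ᵥ y) ≤ b * euclNorm y) (p : Polynomial ℝ) {M : ℝ} (hM : 0 ≤ M)
    (hp : ∀ t, a ^ 2 ≤ t → t ≤ b ^ 2 → |p.eval t| ≤ M) (u : Fin n → ℝ) :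
    euclNorm (B *ᵥ (Polynomial.aeval (Bᵀ * B) p *ᵥ u)) ≤ M * euclNorm (B *ᵥ u) := by
  obtain ⟨Q, hQ, hQ', hB⟩ := exists_gram_diagonalization B
  set w : Fin n → ℝ := fun i => (Matrix.toEuclideanLin B).singularValues i ^ 2
  set c := Qᵀ *ᵥ u with hc
  have hquad : ∀ v : Fin n → ℝ, euclNorm (B *ᵥ (Q *ᵥ v)) ^ 2 = ∑ i, w i * v i ^ 2 := by
    intro v
    have h1 : (B * Q)ᵀ * (B * Q) = Matrix.diagonal w := by
      rw [Matrix.transpose_mul, Matrix.mul_assoc, ← Matrix.mul_assoc Bᵀ, hB]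
      calc _ = (Qᵀ * Q) * Matrix.diagonal w * (Qᵀ * Q) := by simp only [w, Matrix.mul_assoc]
        _ = _ := by rw [hQ, Matrix.one_mul, Matrix.mul_one]
    rw [euclNorm_sq, Matrix.mulVec_mulVec, mulVec_dotProduct_mulVec, h1, dotProduct]
    refine Finset.sum_congr rfl fun i _ => ?_
    rw [Matrix.mulVec_diagonal]
    ring
  have hw : ∀ i, a ^ 2 ≤ w i ∧ w i ≤ b ^ 2 := by
    intro i
    have h1 : euclNorm (B *ᵥ (Q *ᵥ Pi.single i 1)) ^ 2 = w i := by
      rw [hquad, Finset.sum_eq_single i] <;> simp +contextual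
    have h2 : euclNorm (Q *ᵥ Pi.single i 1) = 1 := by
      rw [euclNorm_of_orthonormal hQ, ← sq_eq_sq₀ (euclNorm_nonneg _) zero_le_one, euclNorm_sq,
        single_dotProduct, Pi.single_eq_same]
      norm_num
    have h3 := hlo (Q *ᵥ Pi.single i 1)
    have h4 := hhi (Q *ᵥ Pi.single i 1)
    rw [h2, mul_one] at h3 h4
    rw [← h1]
    exact ⟨pow_le_pow_left₀ ha h3 2, pow_le_pow_left₀ (euclNorm_nonneg _) h4 2⟩
  have hu : u = Q *ᵥ c := by rw [hc, Matrix.mulVec_mulVec, hQ', Matrix.one_mulVec]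
  have hpu : Polynomial.aeval (Bᵀ * B) p *ᵥ u = Q *ᵥ fun i => p.eval (w i) * c i := by
    rw [hB, aeval_conj_diagonal hQ hQ', ← Matrix.mulVec_mulVec, ← hc, ← Matrix.mulVec_mulVec]
    congr 1
    ext i
    rw [Matrix.mulVec_diagonal]
  refine le_of_sq_le_sq ?_ (mul_nonneg hM (euclNorm_nonneg _))
  rw [mul_pow, hpu, hquad]
  conv_rhs => rw [hu, hquad]
  rw [Finset.mul_sum]
  refine Finset.sum_le_sum fun i _ => ?_
  have h1 : p.eval (w i) ^ 2 ≤ M ^ 2 := sq_le_sq' (neg_le_of_abs_le (hp _ (hw i).1 (hw i).2))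
    (le_of_abs_le (hp _ (hw i).1 (hw i).2))
  have h2 : 0 ≤ w i * c i ^ 2 := mul_nonneg (sq_nonneg _) (sq_nonneg _)
  calc w i * (p.eval (w i) * c i) ^ 2 = p.eval (w i) ^ 2 * (w i * c i ^ 2) := by ring
    _ ≤ M ^ 2 * (w i * c i ^ 2) := mul_le_mul_of_nonneg_right h1 h2

theorem aeval_mulVec_mem_krylov {n : ℕ} (G : Matrix (Fin n) (Fin n) ℝ) (v : Fin n → ℝ) {k : ℕ}
    {q : Polynomial ℝ} (hq : ∀ j, k ≤ j → q.coeff j = 0) :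
    Polynomial.aeval G q *ᵥ v ∈ krylov G v k := by
  rw [Polynomial.aeval_eq_sum_range, Matrix.sum_mulVec]
  refine Submodule.sum_mem _ fun j _ => ?_
  by_cases hj : j < k
  · rw [Matrix.smul_mulVec]
    exact Submodule.smul_mem _ _ (Submodule.subset_span ⟨j, hj, rfl⟩)
  · rw [hq j (not_lt.mp hj), zero_smul, Matrix.zero_mulVec]
    exact Submodule.zero_mem _

/-- The convergence bound of LSQR; `u` is a solution of the least-squares problem. -/
theorem IsLSQRIterate.euclNorm_le {α : Type*} [Fintype α] {n k : ℕ} {B : Matrix α (Fin n) ℝ}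
    {r : α → ℝ} {y : Fin n → ℝ} (hy : IsLSQRIterate B r k y) {a b : ℝ} (ha : 0 < a) (hab : a < b)
    (hlo : ∀ y, a * euclNorm y ≤ euclNorm (B *ᵥ y))
    (hhi : ∀ y, euclNorm (B *ᵥ y) ≤ b * euclNorm y) {u : Fin n → ℝ}
    (hu : Bᵀ *ᵥ (B *ᵥ u - r) = 0) :
    euclNorm (B *ᵥ (y - u)) ≤ 2 * ((b - a) / (b + a)) ^ k * euclNorm (B *ᵥ u) := by
  obtain ⟨p, hdeg, hp0, hp⟩ := exists_chebyshev_residual ha hab k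
  have hGu : Bᵀ *ᵥ r = (Bᵀ * B) *ᵥ u := by
    rw [Matrix.mulVec_sub, sub_eq_zero] at hu
    rw [← hu, Matrix.mulVec_mulVec]
  -- The residual at `u` is orthogonal to the range of `B`, so minimizing the residual is minimizing
  -- `‖B(z - u)‖`.
  have hpyth : ∀ z, euclNorm (B *ᵥ z - r) ^ 2 =
      euclNorm (B *ᵥ (z - u)) ^ 2 + euclNorm (B *ᵥ u - r) ^ 2 := by
    intro z
    have h1 : B *ᵥ z - r = B *ᵥ (z - u) + (B *ᵥ u - r) := by
      rw [Matrix.mulVec_sub]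
      abel
    have h2 : (B *ᵥ (z - u)) ⬝ᵥ (B *ᵥ u - r) = 0 := by
      rw [← Matrix.vecMul_transpose, ← Matrix.dotProduct_mulVec, hu, dotProduct_zero]
    rw [h1, euclNorm_sq, euclNorm_sq, euclNorm_sq, add_dotProduct, dotProduct_add, dotProduct_add,
      h2, dotProduct_comm (B *ᵥ u - r), h2]
    ring
  -- `q = (1 - p)/X` has no terms of degree `k` or more, and the comparison iterate `q(BᵀB)Bᵀr` has
  -- error `-p(BᵀB)u`.
  set q := -p.divX with hq
  set z := Polynomial.aeval (Bᵀ * B) q *ᵥ (Bᵀ *ᵥ r) with hz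
  have hzmem : z ∈ krylov (Bᵀ * B) (Bᵀ *ᵥ r) k := by
    refine aeval_mulVec_mem_krylov _ _ fun j hj => ?_
    rw [hq, Polynomial.coeff_neg, Polynomial.coeff_divX,
      Polynomial.coeff_eq_zero_of_natDegree_lt (by omega), neg_zero]
  have hzu : B *ᵥ (z - u) = -(B *ᵥ (Polynomial.aeval (Bᵀ * B) p *ᵥ u)) := by
    have h1 : Polynomial.aeval (Bᵀ * B) p =
        Polynomial.aeval (Bᵀ * B) p.divX * (Bᵀ * B) + 1 := by
      conv_lhs => rw [← Polynomial.divX_mul_X_add p]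
      rw [hp0]
      simp
    have h2 : z - u = -(Polynomial.aeval (Bᵀ * B) p *ᵥ u) := by
      rw [h1, hz, hq, hGu, map_neg, Matrix.neg_mulVec, Matrix.mulVec_mulVec, Matrix.add_mulVec,
        Matrix.one_mulVec, neg_add, sub_eq_add_neg]
    rw [h2, Matrix.mulVec_neg]
  have hle : euclNorm (B *ᵥ (y - u)) ≤ euclNorm (B *ᵥ (z - u)) := by
    refine le_of_sq_le_sq ?_ (euclNorm_nonneg _)
    have h1 := pow_le_pow_left₀ (euclNorm_nonneg _) (hy.2 z hzmem) 2
    rw [hpyth y, hpyth z] at h1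
    linarith
  refine hle.trans ?_
  rw [hzu, euclNorm, WithLp.toLp_neg, norm_neg]
  have hM : 0 ≤ 2 * ((b - a) / (b + a)) ^ k := by
    have : 0 < b - a := sub_pos.mpr hab
    have : 0 < b + a := by linarith
    positivity
  exact euclNorm_mulVec_aeval_le B ha.le hlo hhi p hM hp u

/-! ### Spectral bounds for the preconditioned augmented matrix -/

theorem euclNorm_sumElim_sq {α β : Type*} [Fintype α] [Fintype β] (x : α → ℝ) (y : β → ℝ) :
    euclNorm (Sum.elim x y) ^ 2 = euclNorm x ^ 2 + euclNorm y ^ 2 := by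
  simp [euclNorm_sq, dotProduct]

theorem euclNorm_add_le {α : Type*} [Fintype α] (x y : α → ℝ) :
    euclNorm (x + y) ≤ euclNorm x + euclNorm y := by
  rw [euclNorm, WithLp.toLp_add]
  exact norm_add_le _ _

theorem augMatrix_mulVec {m n : ℕ} (A : Matrix (Fin m) (Fin n) ℝ) (μ : ℝ) (x : Fin n → ℝ) :
    augMatrix A μ *ᵥ x = Sum.elim (A *ᵥ x) (μ • x) := by
  rw [augMatrix, Matrix.fromRows_mulVec, Matrix.smul_mulVec, Matrix.one_mulVec]

theorem euclNorm_augMatrix_mulVec_sq {m n : ℕ} (A : Matrix (Fin m) (Fin n) ℝ) (μ : ℝ)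
    (x : Fin n → ℝ) :
    euclNorm (augMatrix A μ *ᵥ x) ^ 2 = euclNorm (A *ᵥ x) ^ 2 + μ ^ 2 * euclNorm x ^ 2 := by
  rw [augMatrix_mulVec, euclNorm_sumElim_sq, euclNorm_smul, mul_pow, sq_abs]

theorem ThinSVD.mulVec_eq {α β : Type*} [Fintype α] [Fintype β] {M : Matrix α β ℝ} {k : ℕ}
    (svd : ThinSVD M k) (x : β → ℝ) :
    M *ᵥ x = svd.U *ᵥ (Matrix.diagonal svd.s *ᵥ (svd.Vᵀ *ᵥ x)) :=
  (congrArg (· *ᵥ x) svd.eq).trans (by simp only [Matrix.mulVec_mulVec, Matrix.mul_assoc])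

theorem ThinSVD.mul_transpose_mul {α β : Type*} [Fintype α] [Fintype β] {M : Matrix α β ℝ} {k : ℕ}
    (svd : ThinSVD M k) : svd.U * (svd.Uᵀ * M) = M := by
  have h : svd.U * (svd.Uᵀ * M) = svd.U * (svd.Uᵀ * (svd.U * Matrix.diagonal svd.s * svd.Vᵀ)) :=
    congrArg (fun N => svd.U * (svd.Uᵀ * N)) svd.eq
  rw [h, ← Matrix.mul_assoc svd.Uᵀ, ← Matrix.mul_assoc svd.Uᵀ, svd.U_orthonormal, Matrix.one_mul,
    ← Matrix.mul_assoc, ← svd.eq]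

section

variable {m n : ℕ} {A : Matrix (Fin m) (Fin n) ℝ} (ph : Phase A)

theorem euclNorm_orthonormal_add_sq {k : ℕ} {V : Matrix (Fin n) (Fin k) ℝ} (hV : Vᵀ * V = 1)
    (c : Fin k → ℝ) (w : Fin n → ℝ) :
    euclNorm (V *ᵥ c + (w - V *ᵥ (Vᵀ *ᵥ w))) ^ 2 =
      euclNorm c ^ 2 + euclNorm (w - V *ᵥ (Vᵀ *ᵥ w)) ^ 2 := by
  have h : (V *ᵥ c) ⬝ᵥ (w - V *ᵥ (Vᵀ *ᵥ w)) = 0 := by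
    rw [← Matrix.vecMul_transpose, ← Matrix.dotProduct_mulVec, Matrix.mulVec_sub,
      Matrix.mulVec_mulVec, hV, Matrix.one_mulVec, sub_self, dotProduct_zero]
  rw [← euclNorm_of_orthonormal hV c, euclNorm_sq, euclNorm_sq, euclNorm_sq, add_dotProduct,
    dotProduct_add, dotProduct_add, h, dotProduct_comm (w - _), h]
  ring

/-- The part of `w` in the orthogonal complement of the computed right singular vectors. -/
def Phase.rest (w : Fin n → ℝ) : Fin n → ℝ :=
  w - ph.svd.V *ᵥ (ph.svd.Vᵀ *ᵥ w)

theorem Phase.euclNorm_sq_eq (w : Fin n → ℝ) :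
    euclNorm w ^ 2 = ∑ j, (ph.svd.Vᵀ *ᵥ w) j ^ 2 + euclNorm (ph.rest w) ^ 2 := by
  have h := euclNorm_orthonormal_add_sq ph.svd.V_orthonormal (ph.svd.Vᵀ *ᵥ w) w
  rw [add_sub_cancel] at h
  rw [h, euclNorm_sq (ph.svd.Vᵀ *ᵥ w), Phase.rest]
  simp [dotProduct, sq]

theorem Phase.euclNorm_precond_sq (μ : ℝ) (w : Fin n → ℝ) :
    euclNorm (ph.precond μ *ᵥ w) ^ 2 =
      ∑ j, (ph.svd.s j ^ 2 + μ ^ 2) / ph.level ^ 2 * (ph.svd.Vᵀ *ᵥ w) j ^ 2 +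
        euclNorm (ph.rest w) ^ 2 := by
  have h := euclNorm_orthonormal_add_sq ph.svd.V_orthonormal
    ((1 / ph.level) • (Matrix.diagonal (fun j => √(ph.svd.s j ^ 2 + μ ^ 2)) *ᵥ
      (ph.svd.Vᵀ *ᵥ w))) w
  have h1 : ph.precond μ *ᵥ w = ph.svd.V *ᵥ ((1 / ph.level) •
      (Matrix.diagonal (fun j => √(ph.svd.s j ^ 2 + μ ^ 2)) *ᵥ (ph.svd.Vᵀ *ᵥ w))) +
      (w - ph.svd.V *ᵥ (ph.svd.Vᵀ *ᵥ w)) := by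
    simp only [Phase.precond, Matrix.add_mulVec, Matrix.smul_mulVec, Matrix.sub_mulVec,
      Matrix.one_mulVec, ← Matrix.mulVec_mulVec, Matrix.mulVec_smul]
  rw [h1, h, Phase.rest, euclNorm_sq, dotProduct]
  congr 1
  refine Finset.sum_congr rfl fun j _ => ?_
  have h2 : √(ph.svd.s j ^ 2 + μ ^ 2) ^ 2 = ph.svd.s j ^ 2 + μ ^ 2 := Real.sq_sqrt (by positivity)
  rw [Pi.smul_apply, smul_eq_mul, Matrix.mulVec_diagonal, ← sq, mul_pow, mul_pow, h2]
  ring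

theorem Phase.euclNorm_augMatrix_approx_sq (μ : ℝ) (w : Fin n → ℝ) :
    euclNorm (augMatrix ph.cur.approx μ *ᵥ w) ^ 2 =
      ∑ j, (ph.svd.s j ^ 2 + μ ^ 2) * (ph.svd.Vᵀ *ᵥ w) j ^ 2 +
        μ ^ 2 * euclNorm (ph.rest w) ^ 2 := by
  rw [euclNorm_augMatrix_mulVec_sq, ph.svd.mulVec_eq, euclNorm_of_orthonormal ph.svd.U_orthonormal,
    ph.euclNorm_sq_eq w, euclNorm_sq (Matrix.diagonal ph.svd.s *ᵥ (ph.svd.Vᵀ *ᵥ w)), dotProduct,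
    mul_add, Finset.mul_sum, ← add_assoc, ← Finset.sum_add_distrib]
  congr 1
  refine Finset.sum_congr rfl fun j _ => ?_
  rw [Matrix.mulVec_diagonal]
  ring

variable {ph} {μ : ℝ}

theorem Phase.level_sq_le (hlev : ph.level ^ 2 ≤ ph.lastSigma ^ 2 + μ ^ 2) (j : Fin ph.rank) :
    ph.level ^ 2 ≤ ph.svd.s j ^ 2 + μ ^ 2 := by
  refine hlev.trans (add_le_add_left ?_ _)
  refine pow_le_pow_left₀ (ph.svd.s_nonneg _) (ph.svd.s_antitone ?_) 2
  exact Fin.mk_le_mk.mpr (Nat.le_sub_one_of_lt j.2)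

/-- On the computed singular directions `P` scales by `√(s_j² + μ²)/σ̂ ≥ 1`, elsewhere by `1`. This
gives invertibility and lets `‖E P⁻¹‖ ≤ ‖E‖`. -/
theorem Phase.euclNorm_le_precond (hlev : ph.level ^ 2 ≤ ph.lastSigma ^ 2 + μ ^ 2)
    (w : Fin n → ℝ) : euclNorm w ≤ euclNorm (ph.precond μ *ᵥ w) := by
  refine le_of_sq_le_sq ?_ (euclNorm_nonneg _)
  rw [ph.euclNorm_sq_eq, ph.euclNorm_precond_sq]
  have hl : 0 < ph.level ^ 2 := pow_pos ph.level_pos 2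
  gcongr with j
  refine le_mul_of_one_le_left (sq_nonneg _) ?_
  rw [one_le_div hl]
  exact Phase.level_sq_le hlev j

/-- After preconditioning, the approximate augmented matrix scales by exactly `σ̂` on the range of
`V̂` and by `μ` on its complement; the smaller is `μ`. -/
theorem Phase.le_euclNorm_augMatrix_approx (hμ : 0 < μ) (hμl : μ ≤ ph.level) (w : Fin n → ℝ) :
    μ * euclNorm (ph.precond μ *ᵥ w) ≤ euclNorm (augMatrix ph.cur.approx μ *ᵥ w) := by
  refine le_of_sq_le_sq ?_ (euclNorm_nonneg _)
  rw [mul_pow, ph.euclNorm_precond_sq, ph.euclNorm_augMatrix_approx_sq, mul_add, Finset.mul_sum]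
  have hl : 0 < ph.level ^ 2 := pow_pos ph.level_pos 2
  refine add_le_add_left (Finset.sum_le_sum fun j _ => ?_) _
  rw [← mul_assoc]
  refine mul_le_mul_of_nonneg_right ?_ (sq_nonneg _)
  rw [← mul_div_assoc, div_le_iff₀ hl, mul_comm]
  have := pow_le_pow_left₀ hμ.le hμl 2
  gcongr

theorem Phase.euclNorm_augMatrix_approx_le (hμ : 0 < μ) (hμl : μ ≤ ph.level) (w : Fin n → ℝ) :
    euclNorm (augMatrix ph.cur.approx μ *ᵥ w) ≤ ph.level * euclNorm (ph.precond μ *ᵥ w) := by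
  refine le_of_sq_le_sq ?_ (mul_nonneg ph.level_pos.le (euclNorm_nonneg _))
  rw [mul_pow, ph.euclNorm_precond_sq, ph.euclNorm_augMatrix_approx_sq, mul_add, Finset.mul_sum]
  have hl : 0 < ph.level ^ 2 := pow_pos ph.level_pos 2
  refine add_le_add (Finset.sum_le_sum fun j _ => le_of_eq ?_)
    (mul_le_mul_of_nonneg_right (pow_le_pow_left₀ hμ.le hμl 2) (sq_nonneg _))
  rw [← mul_assoc, mul_div_cancel₀ _ hl.ne']

theorem Phase.isUnit_det_precond (hlev : ph.level ^ 2 ≤ ph.lastSigma ^ 2 + μ ^ 2) :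
    IsUnit (ph.precond μ).det := by
  rw [isUnit_iff_ne_zero, ne_eq, ← Matrix.exists_mulVec_eq_zero_iff]
  rintro ⟨v, hv, h0⟩
  have h1 := Phase.euclNorm_le_precond hlev v
  rw [h0, euclNorm_eq_zero.mpr rfl] at h1
  exact hv (euclNorm_eq_zero.mp (le_antisymm h1 (euclNorm_nonneg v)))

theorem augMatrix_mulVec_eq_add (w : Fin n → ℝ) :
    augMatrix A μ *ᵥ w =
      augMatrix ph.cur.approx μ *ᵥ w + Sum.elim (ph.cur.residual *ᵥ w) 0 := by
  rw [augMatrix_mulVec, augMatrix_mulVec, CUR.residual, Matrix.sub_mulVec]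
  ext (i | i) <;> simp

theorem Phase.euclNorm_residual_le (hlev : ph.level ^ 2 ≤ ph.lastSigma ^ 2 + μ ^ 2)
    (w : Fin n → ℝ) :
    euclNorm (Sum.elim (ph.cur.residual *ᵥ w) (0 : Fin n → ℝ)) ≤
      ‖ph.cur.residual‖ * euclNorm (ph.precond μ *ᵥ w) := by
  have h1 : euclNorm (Sum.elim (ph.cur.residual *ᵥ w) (0 : Fin n → ℝ)) =
      euclNorm (ph.cur.residual *ᵥ w) := by
    rw [← sq_eq_sq₀ (euclNorm_nonneg _) (euclNorm_nonneg _), euclNorm_sumElim_sq,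
      euclNorm_eq_zero.mpr rfl]
    ring
  rw [h1]
  exact (euclNorm_mulVec_le _ _).trans
    (mul_le_mul_of_nonneg_left (Phase.euclNorm_le_precond hlev w) (norm_nonneg _))

theorem Phase.le_euclNorm_preconditioned (hμ : 0 < μ) (hμl : μ ≤ ph.level)
    (hlev : ph.level ^ 2 ≤ ph.lastSigma ^ 2 + μ ^ 2) (y : Fin n → ℝ) :
    (μ - ‖ph.cur.residual‖) * euclNorm y ≤
      euclNorm ((augMatrix A μ * (ph.precond μ)⁻¹) *ᵥ y) := by
  set w := (ph.precond μ)⁻¹ *ᵥ y with hw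
  have hy : ph.precond μ *ᵥ w = y := by
    rw [hw, Matrix.mulVec_mulVec, Matrix.mul_nonsing_inv _ (Phase.isUnit_det_precond hlev),
      Matrix.one_mulVec]
  rw [← Matrix.mulVec_mulVec, ← hw]
  have h1 := Phase.le_euclNorm_augMatrix_approx hμ hμl w
  have h2 := Phase.euclNorm_residual_le hlev w
  rw [hy] at h1 h2
  have h3 := euclNorm_add_le (augMatrix A μ *ᵥ w) (-Sum.elim (ph.cur.residual *ᵥ w) 0)
  rw [augMatrix_mulVec_eq_add (ph := ph), add_neg_cancel_right,
    ← augMatrix_mulVec_eq_add (ph := ph)] at h3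
  have h4 : euclNorm (-Sum.elim (ph.cur.residual *ᵥ w) (0 : Fin n → ℝ)) =
      euclNorm (Sum.elim (ph.cur.residual *ᵥ w) (0 : Fin n → ℝ)) := by
    rw [euclNorm, WithLp.toLp_neg, norm_neg, euclNorm]
  linarith

theorem Phase.euclNorm_preconditioned_le (hμ : 0 < μ) (hμl : μ ≤ ph.level)
    (hlev : ph.level ^ 2 ≤ ph.lastSigma ^ 2 + μ ^ 2) (y : Fin n → ℝ) :
    euclNorm ((augMatrix A μ * (ph.precond μ)⁻¹) *ᵥ y) ≤
      (ph.level + ‖ph.cur.residual‖) * euclNorm y := by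
  set w := (ph.precond μ)⁻¹ *ᵥ y with hw
  have hy : ph.precond μ *ᵥ w = y := by
    rw [hw, Matrix.mulVec_mulVec, Matrix.mul_nonsing_inv _ (Phase.isUnit_det_precond hlev),
      Matrix.one_mulVec]
  rw [← Matrix.mulVec_mulVec, ← hw, augMatrix_mulVec_eq_add (ph := ph)]
  have h1 := Phase.euclNorm_augMatrix_approx_le hμ hμl w
  have h2 := Phase.euclNorm_residual_le hlev w
  rw [hy] at h1 h2
  have h3 := euclNorm_add_le (augMatrix ph.cur.approx μ *ᵥ w)
    (Sum.elim (ph.cur.residual *ᵥ w) 0)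
  linarith

/-! ### Contraction in one phase and the product over phases -/

theorem ThinSVD.s_ne_zero (hμ : 0 < μ) (svd : ThinSVD (augMatrix A μ) n) (j : Fin n) :
    svd.s j ≠ 0 := by
  intro h
  have h1 : augMatrix A μ *ᵥ (svd.V *ᵥ Pi.single j 1) = 0 := by
    rw [svd.mulVec_eq, Matrix.mulVec_mulVec _ svd.Vᵀ, svd.V_orthonormal, Matrix.one_mulVec]
    have : Matrix.diagonal svd.s *ᵥ Pi.single j 1 = 0 := by
      ext i
      rw [Matrix.mulVec_diagonal]
      by_cases hij : i = j
      · rw [hij, h, zero_mul, Pi.zero_apply]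
      · rw [Pi.single_eq_of_ne hij, mul_zero, Pi.zero_apply]
    rw [this, Matrix.mulVec_zero]
  have h2 := euclNorm_augMatrix_mulVec_sq A μ (svd.V *ᵥ Pi.single j 1)
  rw [h1, euclNorm_of_orthonormal svd.V_orthonormal, euclNorm_sq 0, dotProduct_zero,
    euclNorm_sq (Pi.single j 1), single_dotProduct, Pi.single_eq_same] at h2
  nlinarith [sq_nonneg (euclNorm (A *ᵥ (svd.V *ᵥ Pi.single j 1)))]

/-- The block `μ I` makes all singular values nonzero, so `Σ` can be inverted. This yields a
least-squares solution. -/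
theorem ThinSVD.exists_augMatrix_mulVec_eq (hμ : 0 < μ) (svd : ThinSVD (augMatrix A μ) n)
    (r : Fin m ⊕ Fin n → ℝ) : ∃ w, augMatrix A μ *ᵥ w = svd.U *ᵥ (svd.Uᵀ *ᵥ r) := by
  refine ⟨svd.V *ᵥ (Matrix.diagonal (fun j => (svd.s j)⁻¹) *ᵥ (svd.Uᵀ *ᵥ r)), ?_⟩
  rw [svd.mulVec_eq, Matrix.mulVec_mulVec _ svd.Vᵀ, svd.V_orthonormal, Matrix.one_mulVec,
    Matrix.mulVec_mulVec _ (Matrix.diagonal svd.s),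
    Matrix.diagonal_mul_diagonal]
  have : (fun i => svd.s i * (svd.s i)⁻¹) = 1 := by
    ext j
    exact mul_inv_cancel₀ (svd.s_ne_zero hμ j)
  rw [this, Matrix.diagonal_one', Matrix.one_mulVec]

/-- One phase contracts the component of the residual in the range of `A_μ`. -/
theorem Phase.Step.euclNorm_le {b : Fin m → ℝ} {x x' : Fin n → ℝ} (hstep : ph.Step b μ x x')
    (hμ : 0 < μ) (hμl : μ ≤ ph.level) (hlev : ph.level ^ 2 ≤ ph.lastSigma ^ 2 + μ ^ 2) {ε : ℝ}
    (hres : ‖ph.cur.residual‖ < μ) (hε : ‖ph.cur.residual‖ ≤ ε)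
    (svd : ThinSVD (augMatrix A μ) n) :
    euclNorm (svd.Uᵀ *ᵥ augResidual A b μ x') ≤
      2 * (1 - 2 * (μ - ε) / (μ + √(ph.level ^ 2 + μ ^ 2))) ^ ph.iters *
        euclNorm (svd.Uᵀ *ᵥ augResidual A b μ x) := by
  obtain ⟨y, hy, rfl⟩ := hstep
  have hunit := Phase.isUnit_det_precond hlev
  set P := ph.precond μ with hP
  set B := augMatrix A μ * P⁻¹ with hB
  set r := augVec n b - augMatrix A μ *ᵥ x with hr
  set s := √(ph.level ^ 2 + μ ^ 2) with hs
  set e := ‖ph.cur.residual‖ with he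
  have he0 : 0 ≤ e := norm_nonneg _
  have hls : ph.level ≤ s := Real.le_sqrt_of_sq_le (by nlinarith)
  have hμs : μ < s := Real.lt_sqrt_of_sq_lt (by nlinarith [ph.level_pos])
  obtain ⟨w, hw⟩ := svd.exists_augMatrix_mulVec_eq hμ r
  have hBu : B *ᵥ (P *ᵥ w) = svd.U *ᵥ (svd.Uᵀ *ᵥ r) := by
    rw [hB, Matrix.mulVec_mulVec, Matrix.mul_assoc, Matrix.nonsing_inv_mul _ hunit, Matrix.mul_one,
      hw]
  have hUB : svd.U * (svd.Uᵀ * B) = B := by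
    rw [hB, ← Matrix.mul_assoc svd.Uᵀ, ← Matrix.mul_assoc, svd.mul_transpose_mul]
  have hUr : svd.Uᵀ *ᵥ (svd.U *ᵥ (svd.Uᵀ *ᵥ r) - r) = 0 := by
    rw [Matrix.mulVec_sub, Matrix.mulVec_mulVec, svd.U_orthonormal, Matrix.one_mulVec, sub_self]
  have hnormal : Bᵀ *ᵥ (B *ᵥ (P *ᵥ w) - r) = 0 := by
    rw [hBu]
    conv_lhs => rw [← hUB]
    rw [Matrix.transpose_mul, ← Matrix.mulVec_mulVec, hUr, Matrix.mulVec_zero]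
  -- The upper bound `σ̂ + e` is relaxed to `s + e`: then `a + b = μ + s` is free of `e`, and `a <
  -- b` holds even when `σ̂ = μ` and `e = 0`.
  have hbound := hy.euclNorm_le (a := μ - e) (b := s + e) (by linarith) (by linarith)
    (Phase.le_euclNorm_preconditioned hμ hμl hlev)
    (fun v => (Phase.euclNorm_preconditioned_le hμ hμl hlev v).trans
      (mul_le_mul_of_nonneg_right (by linarith) (euclNorm_nonneg _))) hnormal
  have hnew : svd.Uᵀ *ᵥ augResidual A b μ (x + P⁻¹ *ᵥ y) =
      svd.Uᵀ *ᵥ (B *ᵥ (y - P *ᵥ w)) := by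
    have h1 : augResidual A b μ (x + P⁻¹ *ᵥ y) =
        B *ᵥ (y - P *ᵥ w) + (svd.U *ᵥ (svd.Uᵀ *ᵥ r) - r) := by
      rw [augResidual, Matrix.mulVec_add, Matrix.mulVec_sub, hBu, hB, hr, Matrix.mulVec_mulVec]
      abel
    rw [h1, Matrix.mulVec_add, hUr, add_zero]
  -- The range of `B` lies in that of `U`, so `Uᵀ` preserves norms there.
  have hnew' : euclNorm (svd.Uᵀ *ᵥ augResidual A b μ (x + P⁻¹ *ᵥ y)) =
      euclNorm (B *ᵥ (y - P *ᵥ w)) := by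
    rw [hnew, ← euclNorm_of_orthonormal svd.U_orthonormal, Matrix.mulVec_mulVec,
      Matrix.mulVec_mulVec, Matrix.mul_assoc, hUB]
  have hold : euclNorm (B *ᵥ (P *ᵥ w)) = euclNorm (svd.Uᵀ *ᵥ augResidual A b μ x) := by
    have h1 : r = -augResidual A b μ x := by rw [hr, augResidual, neg_sub]
    rw [hBu, euclNorm_of_orthonormal svd.U_orthonormal, h1, Matrix.mulVec_neg, euclNorm,
      WithLp.toLp_neg, norm_neg, euclNorm]
  rw [hold] at hbound
  rw [hnew']
  refine hbound.trans (mul_le_mul_of_nonneg_right ?_ (euclNorm_nonneg _))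
  have hden : 0 < μ + s := by linarith
  have hrate : (s + e - (μ - e)) / (s + e + (μ - e)) = 1 - 2 * (μ - e) / (μ + s) := by
    rw [show s + e + (μ - e) = μ + s by ring]
    field_simp
    ring
  have hrate0 : 0 ≤ (s + e - (μ - e)) / (s + e + (μ - e)) :=
    div_nonneg (by linarith) (by linarith)
  refine mul_le_mul_of_nonneg_left (pow_le_pow_left₀ hrate0 ?_ _) zero_le_two
  rw [hrate]
  gcongr

end

theorem le_prod_mul_of_step {p : ℕ} (c : Fin p → ℝ) (a : Fin (p + 1) → ℝ) (hc : ∀ i, 0 ≤ c i)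
    (h : ∀ i : Fin p, a i.succ ≤ 2 * c i * a i.castSucc) :
    a (Fin.last p) ≤ 2 ^ p * (∏ i, c i) * a 0 := by
  induction p with
  | zero => simp
  | succ p ih =>
    have h1 := ih (fun i => c i.castSucc) (fun i => a i.castSucc) (fun i => hc _)
      fun i => h i.castSucc
    have h2 := h (Fin.last p)
    rw [Fin.prod_univ_castSucc, pow_succ]
    have h3 := mul_le_mul_of_nonneg_left h1
      (mul_nonneg zero_le_two (hc (Fin.last p)) : (0 : ℝ) ≤ 2 * c (Fin.last p))
    rw [Fin.succ_last] at h2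
    refine h2.trans (h3.trans (le_of_eq ?_))
    rw [Fin.castSucc_zero]
    ring

end APLICUR

theorem mainTheorem3 {m n : ℕ} (A : Matrix (Fin m) (Fin n) ℝ) :
    (∀ ℓ : ℕ, ℓ ≤ min m n →
      ∃ c : APLICUR.CUR A ℓ,
        ‖c.residual‖ ≤ APLICUR.curConstant m n ℓ * APLICUR.sigma A (ℓ + 1)) ∧
    (∀ (b : Fin m → ℝ) (μ : ℝ), 0 < μ →
      ∀ (C : ℕ → ℝ) (p : ℕ) (phase : Fin p → APLICUR.Phase A) (x : Fin (p + 1) → Fin n → ℝ),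
        APLICUR.IsRun b μ phase x →
        (∀ i, μ ≤ (phase i).level) →
        (∀ i, (phase i).level ^ 2 ≤ (phase i).lastSigma ^ 2 + μ ^ 2) →
        (∀ i, ‖(phase i).cur.residual‖ < μ) →
        (∀ i, ‖(phase i).cur.residual‖ ≤
          C (phase i).rank * APLICUR.sigma A ((phase i).rank + 1)) →
        ∀ svd : APLICUR.ThinSVD (APLICUR.augMatrix A μ) n,
          APLICUR.euclNorm (svd.Uᵀ *ᵥ APLICUR.augResidual A b μ (x (Fin.last p))) ≤
            2 ^ p *
              (∏ i : Fin p,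
                (1 - 2 * (μ - C (phase i).rank * APLICUR.sigma A ((phase i).rank + 1)) /
                  (μ + √((phase i).level ^ 2 + μ ^ 2))) ^ (phase i).iters) *
              APLICUR.euclNorm (svd.Uᵀ *ᵥ APLICUR.augResidual A b μ (x 0))) := by
  refine ⟨fun ℓ hℓ => APLICUR.exists_cur_norm_residual_le A ℓ hℓ, ?_⟩
  intro b μ hμ C p phase x hrun hμl hlev hres hC svd
  refine APLICUR.le_prod_mul_of_step _
    (fun i => APLICUR.euclNorm (svd.Uᵀ *ᵥ APLICUR.augResidual A b μ (x i))) (fun i => ?_)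
    fun i => (hrun i).euclNorm_le hμ (hμl i) (hlev i) (hres i) (hC i) svd
  refine pow_nonneg ?_ _
  -- Nonnegativity for an arbitrary `C` comes from its bounding a norm; hence `2(μ - Cσ) ≤ 2μ ≤ μ +
  -- s`, and each rate is nonnegative.
  have hε : 0 ≤ C (phase i).rank * APLICUR.sigma A ((phase i).rank + 1) :=
    (norm_nonneg _).trans (hC i)
  have hs : μ ≤ √((phase i).level ^ 2 + μ ^ 2) :=
    Real.le_sqrt_of_sq_le (by nlinarith [sq_nonneg (phase i).level])
  rw [sub_nonneg, div_le_one (by linarith)]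
  linarith
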